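/- Let $\alpha,\gamma_1,\gamma_2\in\mathbb{R}$ with $\alpha\neq 0$ and $\gamma_1>\gamma_2$, and put $\beta_1=(\gamma_1+\gamma_2)/2$, $\beta_2=(\gamma_1-\gamma_2)/2$. For $\varepsilon\in(-1,1)$ let $$Q_{R,\varepsilon}=\frac{D_x^2+x^2}{2}\,I_2+\alpha x\begin{bmatrix}0&1\\1&0\end{bmatrix}+\varepsilon\begin{bmatrix}\gamma_1&0\\0&\gamma_2\end{bmatrix},\qquad D_x=-i\,\frac{d}{dx},$$ be the unbounded operator in $L^2(\mathbb{R};\mathbb{C}^2)$ with maximal domain $\{u\in L^2:\ Q_{R,\varepsilon}u\in L^2\}$ (in the sense of distributions). Let $T_\pm u=u(\cdot\mp\alpha)$ on $L^2(\mathbb{R})$, let $$A+\varepsilon B=\frac{D_x^2+x^2}{2}\,I_2+\varepsilon\begin{bmatrix}\beta_1&\beta_2T_+^2\\ \beta_2T_-^2&\beta_1\end{bmatrix},$$ also with its maximal domain, and let $\varphi_N=\bigl((x-\frac{d}{dx})/\sqrt2\bigr)^Ne^{-x^2/2}$ be the Hermite functions, $N=0,1,2,\dots$. Put $$\mu_\pm=\mu_{\pm,N}=\beta_1\pm\beta_2\,\frac{|(T_+\varphi_N,T_-\varphi_N)_{L^2}|}{\|\varphi_N\|_{L^2}^2}.$$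 Let $L_N(x)=\sum_{j=0}^N(-1)^j\binom Nj\frac{x^j}{j!}$ be the Laguerre polynomials, let $\mathsf{Z}=\{x\ge 0:\ L_k(x)=0\text{ for some }k\}$, and assume that $4\alpha^2\notin\mathsf{Z}$. Then there exist sequences of natural numbers $k_j\nearrow+\infty$ and of positive numbers $\delta_j\searrow0$ (both strictly monotone) such that, for every $j$, all the roots of the polynomials $L_n$ with $n\le k_j$ are at distance at least $\delta_j$ from $4\alpha^2$. Moreover, for any such sequences and every $j$ there are $c_j\in(0,1)$ and, for $0\le N\le k_j$, real-analytic functions $\lambda^{(N)}_\pm:(-c_j,c_j)\to\mathbb{R}$, given on $(-c_j,c_j)$ by convergent power series $$\lambda_\pm^{(N)}(\varepsilon)=\sum_{k\ge0}\lambda_{k,\pm}^{(N)}\varepsilon^k,\qquad \lambda_{0,\pm}^{(N)}=N+\tfrac12,\qquad \lambda_{1,\pm}^{(N)}=\mu_{\pm,N},$$ with $\lambda_\pm^{(N)}(\varepsilon)$ an eigenvalue of $A+\varepsilon B$ for all $|\varepsilon|<c_j$, such that the following holds. Put $\mu_\pm^{(N)}(\varepsilon)=\lambda_\pm^{(N)}(\varepsilon)-\alpha^2/2$.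 For all $|\varepsilon|<c_j$ the numbers $\mu_\pm^{(N)}(\varepsilon)$, $0\le N\le k_j$, are eigenvalues of $Q_{R,\varepsilon}$, and every other eigenvalue of $Q_{R,\varepsilon}$ is larger than all of them. For $0<|\varepsilon|<c_j$ they are $2(k_j+1)$ distinct numbers and each of them is a simple eigenvalue of $Q_{R,\varepsilon}$. Thus, for $0<|\varepsilon|<c_j$, the first $2(k_j+1)$ eigenvalues of $Q_{R,\varepsilon}$ are all simple, and they are the numbers $\mu_\pm^{(N)}(\varepsilon)$, $0\le N\le k_j$. -/

import Mathlib

open MeasureTheory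
open scoped SchwartzMap ENNReal

noncomputable section

namespace Rabi

/-! ### Laguerre polynomials and the set `𝖹` of their zeros -/

/-- The Laguerre polynomial `L_N(x) = ∑_{j ≤ N} (-1)^j (N choose j) x^j / j!`. -/
def laguerre (N : ℕ) (x : ℝ) : ℝ :=
  ∑ j ∈ Finset.range (N + 1), (-1 : ℝ) ^ j * (N.choose j : ℝ) * x ^ j / (j.factorial : ℝ)

/-- The set `𝖹` of the nonnegative zeros of all the Laguerre polynomials. -/
def laguerreZeros : Set ℝ := {x | 0 ≤ x ∧ ∃ k : ℕ, laguerre k x = 0}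

/-- `k_j ↗ +∞` and `δ_j ↘ 0` (with `δ_j > 0`) are such that, for every `j`, all the roots of the
Laguerre polynomials `L_n` with `n ≤ k_j` are at distance at least `δ_j` from `x₀`. -/
structure IsRootSeparating (x₀ : ℝ) (k : ℕ → ℕ) (δ : ℕ → ℝ) : Prop where
  strictMono_k : StrictMono k
  pos_δ : ∀ j, 0 < δ j
  strictAnti_δ : StrictAnti δ
  tendsto_δ : Filter.Tendsto δ Filter.atTop (nhds 0)
  separated : ∀ j, ∀ n ≤ k j, ∀ x : ℝ, laguerre n x = 0 → δ j ≤ |x - x₀|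

/-! ### Hermite functions and the first order coefficients -/

/-- The Hermite functions `φ_N = ((x - d/dx) / √2)^N e^{-x²/2}`. -/
def hermiteFun : ℕ → ℝ → ℝ
  | 0 => fun x => Real.exp (-x ^ 2 / 2)
  | N + 1 => fun x => (x * hermiteFun N x - deriv (hermiteFun N) x) / √2

/-- `(T_+ φ_N, T_- φ_N)_0`, where `T_± u = u(· ∓ α)`. -/
def overlap (α : ℝ) (N : ℕ) : ℝ := ∫ x : ℝ, hermiteFun N (x - α) * hermiteFun N (x + α)

/-- `‖φ_N‖_0²`. -/
def hermiteNormSq (N : ℕ) : ℝ := ∫ x : ℝ, hermiteFun N x ^ 2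

/-- `μ_± = β₁ ± β₂ |(T_+ φ_N, T_- φ_N)_0| / ‖φ_N‖_0²`, with `β₁ = (γ₁ + γ₂) / 2` and
`β₂ = (γ₁ - γ₂) / 2`; the sign is `s`. -/
def firstOrderCoeff (α γ₁ γ₂ : ℝ) (N : ℕ) (s : ℤˣ) : ℝ :=
  (γ₁ + γ₂) / 2 + ((s : ℤ) : ℝ) * ((γ₁ - γ₂) / 2) * (|overlap α N| / hermiteNormSq N)

/-! ### The operators on `L²(ℝ; ℂ²)` -/

/-- `L²(ℝ) = L²(ℝ; ℂ)`. -/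
abbrev L2 := Lp ℂ 2 (volume : Measure ℝ)

/-- `L²(ℝ; ℂ²) = L²(ℝ) ⊕ L²(ℝ)`, the orthogonal sum of Hilbert spaces. -/
abbrev L2C2 := PiLp 2 (fun _ : Fin 2 => L2)

/-- Pairs of tempered distributions on `ℝ`, i.e. `𝓢'(ℝ; ℂ²)`. -/
abbrev DistC2 := Fin 2 → 𝓢'(ℝ, ℂ)

/-- The embedding of `L²(ℝ)` into `𝓢'(ℝ)`. -/
def toDist : L2 →ₗ[ℂ] 𝓢'(ℝ, ℂ) :=
  (Lp.toTemperedDistributionCLM ℂ (volume : Measure ℝ) 2).toLinearMap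

/-- The componentwise embedding of `L²(ℝ; ℂ²)` into `𝓢'(ℝ; ℂ²)`. -/
def toDistC2 : L2C2 →ₗ[ℂ] DistC2 where
  toFun u i := toDist (u i)
  map_add' u v := by ext1 i; simp
  map_smul' a u := by ext1 i; simp

theorem toDistC2_injective : Function.Injective toDistC2 := by
  have h : Function.Injective toDist :=
    LinearMap.ker_eq_bot.1 (Lp.ker_toTemperedDistributionCLM_eq_bot (p := 2))
  intro u v huv
  ext1 i
  exact h (congrFun huv i)

/-- Multiplication by the coordinate `x` on `𝓢'(ℝ)`. -/
def mulX : 𝓢'(ℝ, ℂ) →ₗ[ℂ] 𝓢'(ℝ, ℂ) :=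
  (TemperedDistribution.smulLeftCLM ℂ (fun x : ℝ => (x : ℂ))).toLinearMap

/-- The distributional derivative on `𝓢'(ℝ)`. -/
def ddx : 𝓢'(ℝ, ℂ) →ₗ[ℂ] 𝓢'(ℝ, ℂ) := (TemperedDistribution.derivCLM ℂ).toLinearMap

/-- The harmonic oscillator `(D_x² + x²) / 2` with `D_x = -i d/dx`, on `𝓢'(ℝ)`. -/
def oscillator : 𝓢'(ℝ, ℂ) →ₗ[ℂ] 𝓢'(ℝ, ℂ) :=
  (1 / 2 : ℂ) • (mulX ∘ₗ mulX - ddx ∘ₗ ddx)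

theorem add_add_add_add_comm_aux {M : Type*} [AddCommMonoid M] (a b c d e f : M) :
    (a + b) + (c + d) + (e + f) = (a + c + e) + (b + d + f) := by
  abel

/-- The scalar operator `(D_x² + x²) / 2 I₂` on `𝓢'(ℝ; ℂ²)`. -/
def oscillatorDist : DistC2 →ₗ[ℂ] DistC2 where
  toFun w := ![oscillator (w 0), oscillator (w 1)]
  map_add' v w := by
    funext i
    fin_cases i <;> simp
  map_smul' a w := by
    funext i
    fin_cases i <;> simp

/-- The Rabi system on `𝓢'(ℝ; ℂ²)`:
`(D_x² + x²) / 2 I₂ + α x [[0, 1], [1, 0]] + ε [[γ₁, 0], [0, γ₂]]`. -/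
def rabiDist (α γ₁ γ₂ ε : ℝ) : DistC2 →ₗ[ℂ] DistC2 where
  toFun w :=
    ![oscillator (w 0) + (α : ℂ) • mulX (w 1) + ((ε * γ₁ : ℝ) : ℂ) • w 0,
      oscillator (w 1) + (α : ℂ) • mulX (w 0) + ((ε * γ₂ : ℝ) : ℂ) • w 1]
  map_add' v w := by
    funext i
    fin_cases i <;> simp only [Pi.add_apply, map_add, smul_add] <;>
      exact add_add_add_add_comm_aux _ _ _ _ _ _
  map_smul' a w := by
    funext i
    fin_cases i <;> simp only [Pi.smul_apply, map_smul, smul_comm _ a] <;> simp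

/-- The translation `u ↦ u(· - a)` on `L²(ℝ)`; thus `T_± = translation (±α)` and
`T_±² = translation (±2α)`. -/
def translation (a : ℝ) : L2 →ₗ[ℂ] L2 :=
  (Lp.compMeasurePreservingₗᵢ ℂ (fun x : ℝ => x - a)
    (measurePreserving_sub_right volume a)).toLinearMap

/-- The bounded operator `B = [[β₁, β₂ T_+²], [β₂ T_-², β₁]]` on `L²(ℝ; ℂ²)`, with
`β₁ = (γ₁ + γ₂) / 2` and `β₂ = (γ₁ - γ₂) / 2`. -/
def perturbation (α γ₁ γ₂ : ℝ) : L2C2 →ₗ[ℂ] L2C2 where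
  toFun u := WithLp.toLp 2
    ![(((γ₁ + γ₂) / 2 : ℝ) : ℂ) • u 0 +
        (((γ₁ - γ₂) / 2 : ℝ) : ℂ) • translation α (translation α (u 1)),
      (((γ₁ - γ₂) / 2 : ℝ) : ℂ) • translation (-α) (translation (-α) (u 0)) +
        (((γ₁ + γ₂) / 2 : ℝ) : ℂ) • u 1]
  map_add' u v := by
    ext1 i
    fin_cases i <;> simp only [PiLp.add_apply, map_add, smul_add] <;> simp <;> abel
  map_smul' a u := by
    ext1 i
    fin_cases i <;> simp only [PiLp.smul_apply, map_smul, smul_comm _ a] <;> simp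

/-- The operator `u ↦ P u + C u` on `L²(ℝ; ℂ²)` with its maximal domain
`{u ∈ L² | P u + C u ∈ L²}`, for a linear operator `P` on `𝓢'(ℝ; ℂ²)` and an everywhere defined
linear operator `C` on `L²(ℝ; ℂ²)`, given by its graph. -/
def maximalGraph (P : DistC2 →ₗ[ℂ] DistC2) (C : L2C2 →ₗ[ℂ] L2C2) : Submodule ℂ (L2C2 × L2C2) :=
  LinearMap.eqLocus
    (P ∘ₗ toDistC2 ∘ₗ LinearMap.fst ℂ L2C2 L2C2 + toDistC2 ∘ₗ C ∘ₗ LinearMap.fst ℂ L2C2 L2C2)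
    (toDistC2 ∘ₗ LinearMap.snd ℂ L2C2 L2C2)

/-- The unbounded operator on `L²(ℝ; ℂ²)` with graph `maximalGraph P C`. -/
def maximalOp (P : DistC2 →ₗ[ℂ] DistC2) (C : L2C2 →ₗ[ℂ] L2C2) : L2C2 →ₗ.[ℂ] L2C2 :=
  (maximalGraph P C).toLinearPMap

theorem mem_graph_maximalOp (P : DistC2 →ₗ[ℂ] DistC2) (C : L2C2 →ₗ[ℂ] L2C2) (u v : L2C2) :
    (u, v) ∈ (maximalOp P C).graph ↔ P (toDistC2 u) + toDistC2 (C u) = toDistC2 v := by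
  unfold maximalOp
  rw [Submodule.toLinearPMap_graph_eq]
  · rfl
  · rintro ⟨x, y⟩ hx hx0
    have hx' : P (toDistC2 x) + toDistC2 (C x) = toDistC2 y := hx
    have hx0' : x = 0 := hx0
    subst hx0'
    apply toDistC2_injective
    rw [← hx']
    simp

/-- The Rabi operator `Q_{R,ε}` on `L²(ℝ; ℂ²)`, with domain `{u ∈ L² | Q_{R,ε} u ∈ L²}`. -/
def rabiOp (α γ₁ γ₂ ε : ℝ) : L2C2 →ₗ.[ℂ] L2C2 := maximalOp (rabiDist α γ₁ γ₂ ε) 0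

/-- The operator `A + ε B` on `L²(ℝ; ℂ²)`, where `A = (D_x² + x²) / 2 I₂`. -/
def conjugatedOp (α γ₁ γ₂ ε : ℝ) : L2C2 →ₗ.[ℂ] L2C2 :=
  maximalOp oscillatorDist ((ε : ℂ) • perturbation α γ₁ γ₂)

/-! ### Eigenvalues of an unbounded operator -/

/-- The eigenspace `Ker (T - ν)` for real `ν`. -/
def eigenspace (T : L2C2 →ₗ.[ℂ] L2C2) (ν : ℝ) : Submodule ℂ L2C2 where
  carrier := {u | (u, (ν : ℂ) • u) ∈ T.graph}
  zero_mem' := by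
    have h := T.graph.zero_mem
    rwa [show (0 : L2C2 × L2C2) = (0, (ν : ℂ) • (0 : L2C2)) by rw [smul_zero]; rfl] at h
  add_mem' {u v} hu hv := by
    have h := T.graph.add_mem hu hv
    rwa [Prod.mk_add_mk, ← smul_add] at h
  smul_mem' a u hu := by
    have h := T.graph.smul_mem a hu
    rwa [Prod.smul_mk, smul_comm a (ν : ℂ) u] at h

/-- `ν` is an eigenvalue of `T`. -/
def IsEigenvalue (T : L2C2 →ₗ.[ℂ] L2C2) (ν : ℝ) : Prop := eigenspace T ν ≠ ⊥

/-- `ν` is a simple eigenvalue of `T`: its eigenspace is one-dimensional. -/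
def IsSimpleEigenvalue (T : L2C2 →ₗ.[ℂ] L2C2) (ν : ℝ) : Prop :=
  Module.finrank ℂ (eigenspace T ν) = 1

/-- `S` consists of the first eigenvalues of `T`: its elements are eigenvalues of `T`, and every
other eigenvalue of `T` is larger than all of them. -/
def IsInitialSetOfEigenvalues (T : L2C2 →ₗ.[ℂ] L2C2) (S : Set ℝ) : Prop :=
  (∀ ν ∈ S, IsEigenvalue T ν) ∧ ∀ ν, IsEigenvalue T ν → ν ∉ S → ∀ σ ∈ S, σ < ν

/-- The numbers `μ_±^{(N)} = λ_±^{(N)} - α²/2`, `0 ≤ N ≤ K`, for a family of numbers `λ_±^{(N)}`. -/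
def shiftedValues (α : ℝ) (K : ℕ) (lam : ℕ → ℤˣ → ℝ) : Set ℝ :=
  {ν | ∃ N ≤ K, ∃ s : ℤˣ, ν = lam N s - α ^ 2 / 2}

end Rabi

end

noncomputable section

namespace Rabi

/-! ### Hermite functions as Schwartz functions -/

/-! Passing to the sum and difference of the two components diagonalizes the coupling `α x`.
Completing the square then absorbs the potentials `± α x` into translations, so `Q_{R,ε}` becomes `A
+ ε B - α²/2` (`mem_eigenspace_rabiOp_iff`). Since the Hermite functions form a Hilbert basis, an
eigenvalue equation on the maximal domain is a family of scalar equations for Hermite coefficients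
(`oscillator_toDist_eq_iff`).

`A + ε B` commutes with the parity `(u₀, u₁) ↦ (u₁(-·), u₀(-·))`. In each sector `u₁ = s u₀(-·)` it
is a scalar operator `D + ε C`, with `D` having the simple eigenvalues `n + 1/2` and `C` bounded and
symmetric. The implicit function theorem gives one analytic branch near each level
(`exists_analytic_eigenvalue`). For small `ε` every eigenvalue is near some level, with only one per
level and sector (`IsPerturbedEigenvector.exists_near`, `IsPerturbedEigenvector.eigenvalue_unique`).
Hence the two sectors over the levels `N ≤ K` supply exactly the lowest eigenvalues.

It remains to exclude crossings of the two sectors. Translating the second component by `2α` makes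
the eigenvalue system a three-term recurrence in Hermite coefficients (`hermCoeff_recurrence`). One
coefficient determines an eigenvector, except when `lam - 1/2 - ε β₁` is a natural number `N` and a
certain polynomial vanishes at `(ε β₂)²`. That polynomial is nonzero (`levelPoly_ne_zero`), so this
exception is absent for small `ε ≠ 0` and finitely many `N`. Eigenspaces are then one-dimensional,
and equal eigenvalues in opposite sectors would contradict this.

The separating sequences exist because no Laguerre polynomial vanishes at `4α²`
(`exists_isRootSeparating`). -/

theorem exists_abs_pow_mul_gaussian_le (k : ℕ) :
    ∃ C : ℝ, ∀ x : ℝ, |x| ^ k * Real.exp (-(x ^ 2 / 2)) ≤ C := by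
  refine ⟨1 + 2 ^ k * k.factorial, fun x => ?_⟩
  have h1 : |x| ^ k ≤ 1 + (x ^ 2) ^ k := by
    rw [← sq_abs, ← pow_mul]
    rcases le_total |x| 1 with h | h
    · exact (pow_le_one₀ (abs_nonneg x) h).trans (le_add_of_nonneg_right (by positivity))
    · exact (pow_le_pow_right₀ h (by omega : k ≤ 2 * k)).trans (by simp)
  have h2 : (x ^ 2) ^ k ≤ 2 ^ k * k.factorial * Real.exp (x ^ 2 / 2) := by
    have := Real.pow_div_factorial_le_exp (x ^ 2 / 2) (by positivity) k
    rw [div_pow, div_div, div_le_iff₀ (by positivity)] at this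
    linarith
  have h3 : 1 ≤ Real.exp (x ^ 2 / 2) := Real.one_le_exp (by positivity)
  rw [Real.exp_neg, ← div_eq_mul_inv, div_le_iff₀ (Real.exp_pos _)]
  linarith

/-- Every derivative of the Gaussian is a Hermite polynomial times the Gaussian, so this is the
decay that a Schwartz function needs. -/
theorem exists_abs_pow_mul_polynomial_mul_gaussian_le (p : Polynomial ℝ) (k : ℕ) :
    ∃ C : ℝ, ∀ x : ℝ, |x| ^ k * |p.eval x * Real.exp (-(x ^ 2 / 2))| ≤ C := by
  induction p using Polynomial.induction_on' with
  | add p q hp hq =>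
    obtain ⟨C, hC⟩ := hp
    obtain ⟨D, hD⟩ := hq
    refine ⟨C + D, fun x => ?_⟩
    rw [Polynomial.eval_add, add_mul]
    calc _ ≤ |x| ^ k * (|p.eval x * Real.exp (-(x ^ 2 / 2))|
          + |q.eval x * Real.exp (-(x ^ 2 / 2))|) := by gcongr; exact abs_add_le _ _
      _ ≤ _ := by rw [mul_add]; exact add_le_add (hC x) (hD x)
  | monomial n a =>
    obtain ⟨C, hC⟩ := exists_abs_pow_mul_gaussian_le (k + n)
    refine ⟨|a| * C, fun x => ?_⟩
    rw [Polynomial.eval_monomial, abs_mul, abs_mul, abs_pow, Real.abs_exp]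
    calc _ = |a| * (|x| ^ (k + n) * Real.exp (-(x ^ 2 / 2))) := by ring
      _ ≤ _ := by gcongr; exact hC x

/-- The Gaussian `e^{-x²/2}` as a real Schwartz function. -/
def gaussianSchwartz : 𝓢(ℝ, ℝ) where
  toFun x := Real.exp (-(x ^ 2 / 2))
  smooth' := by fun_prop
  decay' k n := by
    obtain ⟨C, hC⟩ := exists_abs_pow_mul_polynomial_mul_gaussian_le
      ((Polynomial.hermite n).map (Int.castRingHom ℝ)) k
    refine ⟨C, fun x => ?_⟩
    rw [norm_iteratedFDeriv_eq_norm_iteratedDeriv, iteratedDeriv_eq_iterate,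
      Polynomial.deriv_gaussian_eq_hermite_mul_gaussian]
    refine le_trans (le_of_eq ?_) (hC x)
    simp [Polynomial.aeval_def, Polynomial.eval_map, abs_mul]

/-- Multiplication by `x` on Schwartz functions. -/
def mulS : 𝓢(ℝ, ℂ) →L[ℂ] 𝓢(ℝ, ℂ) := SchwartzMap.smulLeftCLM ℂ (fun x : ℝ => (x : ℂ))

/-- The derivative on Schwartz functions. -/
def derivS : 𝓢(ℝ, ℂ) →L[ℂ] 𝓢(ℝ, ℂ) := SchwartzMap.derivCLM ℂ ℂ

/-- The harmonic oscillator on Schwartz functions. -/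
def oscS (f : 𝓢(ℝ, ℂ)) : 𝓢(ℝ, ℂ) := (1 / 2 : ℂ) • (mulS (mulS f) - derivS (derivS f))

@[simp] theorem mulS_apply (f : 𝓢(ℝ, ℂ)) (x : ℝ) : mulS f x = x * f x := by
  have : (fun x : ℝ => (x : ℂ)).HasTemperateGrowth := by fun_prop
  simp [mulS, this]

@[simp] theorem derivS_apply (f : 𝓢(ℝ, ℂ)) (x : ℝ) : derivS f x = deriv f x := rfl

theorem derivS_mulS (f : 𝓢(ℝ, ℂ)) : derivS (mulS f) = f + mulS (derivS f) := by
  ext x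
  have h : (mulS f : ℝ → ℂ) = fun x : ℝ => (x : ℂ) * f x := funext (mulS_apply f)
  rw [derivS_apply, h]
  have h1 : HasDerivAt (fun x : ℝ => (x : ℂ)) 1 x := Complex.ofRealCLM.hasDerivAt
  have h2 : HasDerivAt (fun x : ℝ => (x : ℂ) * f x) _ x := h1.mul (f.hasDerivAt x)
  rw [h2.deriv]
  simp

/-- The Hermite functions as Schwartz functions. -/
def hermS : ℕ → 𝓢(ℝ, ℂ)
  | 0 => SchwartzMap.postcompCLM Complex.ofRealCLM gaussianSchwartz
  | N + 1 => ((√2 : ℝ) : ℂ)⁻¹ • (mulS (hermS N) - derivS (hermS N))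

theorem hermS_succ (N : ℕ) :
    hermS (N + 1) = ((√2 : ℝ) : ℂ)⁻¹ • (mulS (hermS N) - derivS (hermS N)) := rfl

theorem hermS_apply (N : ℕ) (x : ℝ) : hermS N x = (hermiteFun N x : ℂ) := by
  induction N generalizing x with
  | zero =>
    have h : gaussianSchwartz x = Real.exp (-(x ^ 2 / 2)) := rfl
    simp [hermS, hermiteFun, h, neg_div]
  | succ N ih =>
    have h : (hermS N : ℝ → ℂ) = fun x => (hermiteFun N x : ℂ) := funext ih
    have hd : deriv (hermS N) x = ((deriv (hermiteFun N) x : ℝ) : ℂ) := by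
      have h1 := (hermS N).hasDerivAt x
      have h2 := Complex.reCLM.hasFDerivAt.comp_hasDerivAt x h1
      have h3 : (Complex.reCLM ∘ (hermS N)) = hermiteFun N := by
        funext y; simp [ih]
      rw [h3] at h2
      have h4 := h2.ofReal_comp
      rw [← h] at h4
      rw [h2.deriv]
      exact h4.deriv
    simp only [hermS, hermiteFun, smul_apply, sub_apply, mulS_apply, ih,
      derivS_apply, hd, smul_eq_mul]
    push_cast
    ring

theorem sqrt_two_mul_self : ((√2 : ℝ) : ℂ) * ((√2 : ℝ) : ℂ) = 2 := by
  rw [← Complex.ofReal_mul, Real.mul_self_sqrt (by norm_num)]; simp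

theorem sqrt_two_ne_zero : ((√2 : ℝ) : ℂ) ≠ 0 := by
  intro h
  have := sqrt_two_mul_self
  rw [h] at this
  norm_num at this

theorem mulS_sub_derivS_hermS (N : ℕ) :
    mulS (hermS N) - derivS (hermS N) = ((√2 : ℝ) : ℂ) • hermS (N + 1) := by
  rw [hermS, smul_smul, mul_inv_cancel₀ sqrt_two_ne_zero, one_smul]

theorem mulS_add_derivS_hermS_zero : mulS (hermS 0) + derivS (hermS 0) = 0 := by
  ext x
  have h : (hermS 0 : ℝ → ℂ) = fun x => ((Real.exp (-x ^ 2 / 2) : ℝ) : ℂ) :=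
    funext fun x => by rw [hermS_apply, hermiteFun]
  have h1 : HasDerivAt (fun x : ℝ => Real.exp (-x ^ 2 / 2)) (Real.exp (-x ^ 2 / 2) * (-x)) x := by
    convert! ((((hasDerivAt_id x).pow 2).neg.div_const 2).exp) using 2
    simp; ring
  have h2 := h1.ofReal_comp.deriv
  rw [add_apply, mulS_apply, derivS_apply, h, h2]
  push_cast
  simp; ring

/-- Lowering relation, by induction from the commutator `[d/dx, x] = 1`. The Hermite functions are
not normalized, whence the factor `N + 1` instead of its square root. -/
theorem mulS_add_derivS_hermS_succ (N : ℕ) :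
    mulS (hermS (N + 1)) + derivS (hermS (N + 1)) = (((√2 : ℝ) : ℂ) * (N + 1)) • hermS N := by
  induction N with
  | zero =>
    have h0 : derivS (hermS 0) = - mulS (hermS 0) :=
      eq_neg_of_add_eq_zero_right mulS_add_derivS_hermS_zero
    have h1 : hermS 1 = ((√2 : ℝ) : ℂ) • mulS (hermS 0) := by
      rw [hermS_succ, h0, sub_neg_eq_add, ← two_smul ℂ, smul_smul, ← sqrt_two_mul_self]
      congr 1
      field_simp [sqrt_two_ne_zero]
    rw [zero_add, h1, map_smul, map_smul, derivS_mulS, h0, map_neg, ← smul_add]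
    simp
  | succ N ih =>
    have h0 : mulS (hermS N) = ((√2 : ℝ) : ℂ) • hermS (N + 1) + derivS (hermS N) := by
      rw [← mulS_sub_derivS_hermS]; abel
    have h1 : derivS (hermS (N + 1)) =
        (((√2 : ℝ) : ℂ) * (N + 1)) • hermS N - mulS (hermS (N + 1)) := by
      rw [← ih]; abel
    have h2 : hermS (N + 2) = ((√2 : ℝ) : ℂ)⁻¹ • ((2 : ℂ) • mulS (hermS (N + 1))
        - (((√2 : ℝ) : ℂ) * (N + 1)) • hermS N) := by
      rw [hermS_succ, h1, two_smul]; congr 1; abel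
    rw [h2]
    simp only [map_smul, map_sub, derivS_mulS, h1, h0]
    simp only [← smul_add]
    rw [inv_smul_eq_iff₀ sqrt_two_ne_zero]
    ext x
    have hs := sqrt_two_mul_self
    simp
    generalize ((√2 : ℝ) : ℂ) = s at *
    linear_combination (-(N + 2) * hermS (N + 1) x + (N + 1) * hermS (N + 1) x) * hs

/-- Half the sum of the raising and lowering relations. At `N = 0` the index `N - 1` truncates to
`0`, harmlessly, since its coefficient vanishes. -/
theorem mulS_hermS (N : ℕ) :
    mulS (hermS N) = ((√2 : ℝ) : ℂ)⁻¹ • (hermS (N + 1) + (N : ℂ) • hermS (N - 1)) := by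
  have h : (2 : ℂ) • mulS (hermS N) =
      (mulS (hermS N) - derivS (hermS N)) + (mulS (hermS N) + derivS (hermS N)) := by
    rw [two_smul]; abel
  rw [mulS_sub_derivS_hermS] at h
  rw [eq_inv_smul_iff₀ sqrt_two_ne_zero]
  apply smul_right_injective _ sqrt_two_ne_zero
  dsimp only
  rw [smul_smul, sqrt_two_mul_self, h, smul_add]
  cases N with
  | zero => rw [mulS_add_derivS_hermS_zero]; simp
  | succ N => rw [mulS_add_derivS_hermS_succ, smul_smul]; simp

/-- Twice the oscillator is `(x + d/dx)(x - d/dx) - 1`, so raising and then lowering gives `2(N + 1)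
- 1`. -/
theorem oscS_hermS (N : ℕ) : oscS (hermS N) = ((N : ℂ) + 1 / 2) • hermS N := by
  have h : (2 : ℂ) • oscS (hermS N) = ((√2 : ℝ) : ℂ) •
      (mulS (hermS (N + 1)) + derivS (hermS (N + 1))) - hermS N := by
    rw [smul_add, ← map_smul, ← map_smul, ← mulS_sub_derivS_hermS, map_sub, map_sub, derivS_mulS,
      oscS, smul_smul]
    norm_num
    abel
  rw [mulS_add_derivS_hermS_succ, smul_smul, ← mul_assoc, sqrt_two_mul_self] at h
  apply smul_right_injective _ (two_ne_zero' ℂ)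
  dsimp only
  rw [h, smul_smul]
  nth_rw 2 [← one_smul ℂ (hermS N)]
  rw [← sub_smul]
  congr 1
  ring

theorem hermS_neg (N : ℕ) (x : ℝ) : hermS N (-x) = (-1) ^ N * hermS N x := by
  induction N generalizing x with
  | zero => simp [hermS_apply, hermiteFun]
  | succ N ih =>
    have h : (fun y => hermS N (-y)) = fun y => (-1) ^ N * hermS N y := funext ih
    have hd : deriv (hermS N) (-x) = - ((-1) ^ N * deriv (hermS N) x) := by
      have h1 := deriv_comp_neg (hermS N) x
      rw [h, deriv_const_mul_field] at h1
      rw [h1, neg_neg]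
    simp only [hermS_succ, smul_apply, sub_apply, mulS_apply, ih, derivS_apply, hd, smul_eq_mul]
    push_cast
    ring

theorem hermS_ne_zero (N : ℕ) : hermS N ≠ 0 := by
  induction N with
  | zero =>
    intro h
    have := hermS_apply 0 0
    simp [h, hermiteFun] at this
  | succ N ih =>
    intro h
    have h1 := mulS_add_derivS_hermS_succ N
    rw [h, map_zero, map_zero, add_zero] at h1
    refine smul_ne_zero (mul_ne_zero sqrt_two_ne_zero ?_) ih h1.symm
    exact_mod_cast Nat.succ_ne_zero N

/-! ### Translations and the harmonic oscillator -/

/-- The translation `ψ ↦ ψ(· - a)` of Schwartz functions. -/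
def transS (a : ℝ) : 𝓢(ℝ, ℂ) →L[ℂ] 𝓢(ℝ, ℂ) := SchwartzMap.compSubConstCLM ℂ a

@[simp] theorem transS_apply (a : ℝ) (f : 𝓢(ℝ, ℂ)) (x : ℝ) : transS a f x = f (x - a) := rfl

theorem transS_transS (a b : ℝ) (f : 𝓢(ℝ, ℂ)) : transS a (transS b f) = transS (a + b) f := by
  ext x
  simp [sub_sub]

theorem transS_zero (f : 𝓢(ℝ, ℂ)) : transS 0 f = f := by
  ext x
  simp

theorem derivS_transS (a : ℝ) (f : 𝓢(ℝ, ℂ)) : derivS (transS a f) = transS a (derivS f) := by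
  ext x
  exact deriv_comp_sub_const (f := f) a x

theorem mulS_transS (a : ℝ) (f : 𝓢(ℝ, ℂ)) :
    mulS (transS a f) = transS a (mulS f) + (a : ℂ) • transS a f := by
  ext x
  simp
  ring

/-- Completing the square: `x²/2 + a x = (x + a)²/2 - a²/2`. -/
theorem oscS_add_mulS_transS (a : ℝ) (f : 𝓢(ℝ, ℂ)) :
    oscS (transS (-a) f) + (a : ℂ) • mulS (transS (-a) f) =
      transS (-a) (oscS f) - ((a ^ 2 / 2 : ℝ) : ℂ) • transS (-a) f := by
  simp only [oscS, derivS_transS, mulS_transS, map_add, map_smul, map_sub]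
  ext x
  simp
  ring

/-- The reflection `ψ ↦ ψ(-·)` of Schwartz functions. -/
def reflS : 𝓢(ℝ, ℂ) →L[ℂ] 𝓢(ℝ, ℂ) :=
  SchwartzMap.compCLMOfContinuousLinearEquiv ℂ (ContinuousLinearEquiv.neg ℝ)

@[simp] theorem reflS_apply (f : 𝓢(ℝ, ℂ)) (x : ℝ) : reflS f x = f (-x) := rfl

theorem reflS_hermS (N : ℕ) : reflS (hermS N) = (-1 : ℂ) ^ N • hermS N := by
  ext x
  simp [hermS_neg]

theorem hasSum_of_eq {f g : ℕ → ℂ} {a : ℂ} (h : HasSum f a) (e : ∀ n, f n = g n) : HasSum g a :=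
  (funext e : f = g) ▸ h

/-! ### Square integrable functions as distributions -/

theorem toDist_apply (f : L2) (ψ : 𝓢(ℝ, ℂ)) : toDist f ψ = ∫ x, ψ x * f x := by
  simp [toDist]

theorem toDist_injective : Function.Injective toDist :=
  LinearMap.ker_eq_bot.1 (Lp.ker_toTemperedDistributionCLM_eq_bot (p := 2))

theorem toDist_ext {f g : L2} (h : ∀ ψ, toDist f ψ = toDist g ψ) : f = g :=
  toDist_injective (by ext1 ψ; exact h ψ)

theorem oscillator_toDist_apply (f : L2) (ψ : 𝓢(ℝ, ℂ)) :
    oscillator (toDist f) ψ = toDist f (oscS ψ) := by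
  simp only [oscS, map_smul, map_sub]
  change (1 / 2 : ℂ) • (toDist f (mulS (mulS ψ)) - toDist f (-derivS (-derivS ψ))) = _
  simp

theorem mulX_toDist_apply (f : L2) (ψ : 𝓢(ℝ, ℂ)) : mulX (toDist f) ψ = toDist f (mulS ψ) := rfl

theorem toDist_translation (a : ℝ) (f : L2) (ψ : 𝓢(ℝ, ℂ)) :
    toDist (translation a f) ψ = toDist f (transS (-a) ψ) := by
  rw [toDist_apply, toDist_apply, ← integral_sub_right_eq_self (fun x => transS (-a) ψ x * f x) a]
  refine integral_congr_ae ?_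
  filter_upwards [Lp.coeFn_compMeasurePreserving f (measurePreserving_sub_right volume a)] with x hx
  have hx' : (translation a f) x = f (x - a) := hx
  rw [hx']
  simp

theorem translation_translation (a b : ℝ) (f : L2) :
    translation a (translation b f) = translation (a + b) f := by
  refine toDist_ext fun ψ => ?_
  simp only [toDist_translation, transS_transS]
  congr 2
  ring_nf

theorem translation_zero (f : L2) : translation 0 f = f := by
  refine toDist_ext fun ψ => ?_
  simp [toDist_translation, transS_zero]

theorem translation_neg_translation (a : ℝ) (f : L2) : translation (-a) (translation a f) = f := by
  rw [translation_translation, neg_add_cancel, translation_zero]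

theorem translation_translation_neg (a : ℝ) (f : L2) : translation a (translation (-a) f) = f := by
  rw [translation_translation, add_neg_cancel, translation_zero]

/-- The translation `u ↦ u(· - a)` as an isometry. -/
def translationIso (a : ℝ) : L2 →ₗᵢ[ℂ] L2 :=
  Lp.compMeasurePreservingₗᵢ ℂ (fun x : ℝ => x - a) (measurePreserving_sub_right volume a)

theorem translationIso_apply (a : ℝ) (f : L2) : translationIso a f = translation a f := rfl

/-- The reflection `u ↦ u(-·)` as an isometry. -/
def reflection : L2 →ₗᵢ[ℂ] L2 :=
  Lp.compMeasurePreservingₗᵢ ℂ (fun x : ℝ => -x) (Measure.measurePreserving_neg volume)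

theorem toDist_reflection (f : L2) (ψ : 𝓢(ℝ, ℂ)) :
    toDist (reflection f) ψ = toDist f (reflS ψ) := by
  rw [toDist_apply, toDist_apply, ← integral_neg_eq_self (fun x => reflS ψ x * f x) volume]
  refine integral_congr_ae ?_
  filter_upwards [Lp.coeFn_compMeasurePreserving f (Measure.measurePreserving_neg volume)] with x hx
  have hx' : (reflection f) x = f (-x) := hx
  rw [hx']
  simp

theorem reflection_reflection (f : L2) : reflection (reflection f) = f := by
  refine toDist_ext fun ψ => ?_
  rw [toDist_reflection, toDist_reflection]
  congr 1
  ext x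
  simp

theorem reflection_translation (a : ℝ) (f : L2) :
    reflection (translation a f) = translation (-a) (reflection f) := by
  refine toDist_ext fun ψ => ?_
  rw [toDist_reflection, toDist_translation, toDist_translation, toDist_reflection]
  congr 1
  ext x
  simp
  ring_nf

theorem inner_translation_left (a : ℝ) (f g : L2) :
    inner ℂ (translation a f) g = inner ℂ f (translation (-a) g) := by
  rw [← (translationIso a).inner_map_map f, translationIso_apply, translationIso_apply,
    translation_translation_neg]

theorem inner_reflection_left (f g : L2) :
    inner ℂ (reflection f) g = inner ℂ f (reflection g) := by
  rw [← reflection.inner_map_map f, reflection_reflection]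

/-! ### Hermite coefficients -/

/-- The coefficient `(φ_N, f)` of `f` with respect to the Hermite functions. -/
def hermCoeff (N : ℕ) : L2 →ₗ[ℂ] ℂ where
  toFun f := toDist f (hermS N)
  map_add' f g := by rw [map_add]; rfl
  map_smul' a f := by rw [map_smul]; rfl

theorem hermCoeff_apply (N : ℕ) (f : L2) : hermCoeff N f = toDist f (hermS N) := rfl

theorem hermCoeff_reflection (N : ℕ) (f : L2) :
    hermCoeff N (reflection f) = (-1) ^ N * hermCoeff N f := by
  rw [hermCoeff_apply, toDist_reflection, reflS_hermS, map_smul]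
  rfl

/-- The Hermite functions as elements of `L²`. -/
def hermL (N : ℕ) : L2 := (hermS N).toLp 2

theorem toDist_toLp (f ψ : 𝓢(ℝ, ℂ)) : toDist (f.toLp 2) ψ = ∫ x, ψ x * f x := by
  rw [toDist_apply]
  refine integral_congr_ae ?_
  filter_upwards [f.coeFn_toLp 2 volume] with x hx
  rw [hx]

theorem inner_hermL (N : ℕ) (f : L2) : inner ℂ (hermL N) f = hermCoeff N f := by
  rw [hermCoeff_apply, toDist_apply, L2.inner_def]
  refine integral_congr_ae ?_
  filter_upwards [(hermS N).coeFn_toLp 2 volume] with x hx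
  rw [hermL, hx, RCLike.inner_apply, hermS_apply, mul_comm]
  simp

theorem inner_hermL_self (N : ℕ) : inner ℂ (hermL N) (hermL N) = (hermiteNormSq N : ℂ) := by
  rw [inner_hermL, hermCoeff_apply, hermL, toDist_toLp, hermiteNormSq, ← integral_complex_ofReal]
  refine integral_congr_ae (Filter.Eventually.of_forall fun x => ?_)
  simp [hermS_apply, sq]

theorem hermL_ne_zero (N : ℕ) : hermL N ≠ 0 := by
  intro h
  apply hermS_ne_zero N
  apply SchwartzMap.injective_toLp 2 (volume : Measure ℝ)
  change hermL N = _
  rw [h]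
  exact ((SchwartzMap.toLpCLM ℂ ℂ 2 (volume : Measure ℝ)).map_zero).symm

theorem norm_hermL_sq (N : ℕ) : ‖hermL N‖ ^ 2 = hermiteNormSq N := by
  have := inner_hermL_self N
  rw [inner_self_eq_norm_sq_to_K] at this
  exact Complex.ofReal_injective (by rw [← this]; simp)

/-! ### Symmetry of the oscillator and orthogonality of the Hermite functions. -/

theorem toDist_toLp_derivS (f ψ : 𝓢(ℝ, ℂ)) :
    toDist ((derivS f).toLp 2) ψ = - toDist (f.toLp 2) (derivS ψ) := by
  rw [toDist_toLp, toDist_toLp]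
  exact SchwartzMap.integral_mul_deriv_eq_neg_deriv_mul ψ f

theorem toDist_toLp_mulS (f ψ : 𝓢(ℝ, ℂ)) :
    toDist ((mulS f).toLp 2) ψ = toDist (f.toLp 2) (mulS ψ) := by
  rw [toDist_toLp, toDist_toLp]
  refine integral_congr_ae (Filter.Eventually.of_forall fun x => ?_)
  simp
  ring

/-- The embedding of the Schwartz functions into `L²`. -/
def schwartzL : 𝓢(ℝ, ℂ) →L[ℂ] L2 := SchwartzMap.toLpCLM ℂ ℂ 2 (volume : Measure ℝ)

theorem schwartzL_apply (f : 𝓢(ℝ, ℂ)) : schwartzL f = f.toLp 2 := rfl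

theorem toDist_toLp_oscS (f ψ : 𝓢(ℝ, ℂ)) :
    toDist (schwartzL (oscS f)) ψ = toDist (schwartzL f) (oscS ψ) := by
  have h : toDist (schwartzL (oscS f)) ψ = (1 / 2 : ℂ) • (toDist (schwartzL (mulS (mulS f))) ψ
      - toDist (schwartzL (derivS (derivS f))) ψ) := by
    rw [oscS, map_smul, map_sub, map_smul, map_sub]
    rfl
  rw [h, oscS, map_smul, map_sub]
  simp only [schwartzL_apply, toDist_toLp_mulS, toDist_toLp_derivS, neg_neg]

theorem hermCoeff_schwartzL_oscS (N : ℕ) (f : 𝓢(ℝ, ℂ)) :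
    hermCoeff N (schwartzL (oscS f)) = (N + 1 / 2 : ℂ) * hermCoeff N (schwartzL f) := by
  rw [hermCoeff_apply, toDist_toLp_oscS, oscS_hermS, map_smul]
  rfl

theorem inner_hermL_of_ne {m n : ℕ} (h : m ≠ n) : inner ℂ (hermL m) (hermL n) = 0 := by
  rw [inner_hermL, hermL, ← schwartzL_apply]
  have h1 := hermCoeff_schwartzL_oscS m (hermS n)
  rw [oscS_hermS, map_smul, map_smul, smul_eq_mul, ← sub_eq_zero, ← sub_mul] at h1
  refine (mul_eq_zero.1 h1).resolve_left ?_
  intro h3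
  apply h
  have : (m : ℂ) = n := by linear_combination -h3
  exact_mod_cast this

/-! ### Completeness of the Hermite functions -/

theorem integrable_gaussian_mul_exp (f : L2) (t : ℝ) :
    Integrable (fun x : ℝ => Real.exp (-x ^ 2 / 2) * Real.exp (|t * x|) * ‖f x‖) := by
  have h : MemLp (fun x : ℝ => Real.exp (-x ^ 2 / 2) * Real.exp (|t * x|)) 2 := by
    rw [memLp_two_iff_integrable_sq (by fun_prop)]
    refine Integrable.mono' ((integrable_exp_neg_mul_sq (b := 1 / 2) (by norm_num)).const_mul
      (Real.exp (2 * t ^ 2))) (by fun_prop) (Filter.Eventually.of_forall fun x => ?_)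
    rw [← Real.exp_add, ← Real.exp_add, Real.norm_of_nonneg (by positivity), sq, ← Real.exp_add]
    apply Real.exp_le_exp.2
    -- The bound `-x² + 2|t||x| ≤ 2t² - x²/2` is `(2|t| - |x|)² ≥ 0`.
    rw [abs_mul]
    nlinarith [sq_nonneg (2 * |t| - |x|), sq_abs t, sq_abs x]
  exact h.integrable_mul (Lp.memLp f).norm

/-- By `mulS_hermS`, `xⁿ φ_0` is a finite combination of Hermite functions. -/
theorem integral_pow_mul_gaussian_mul_eq_zero {f : L2} (h : ∀ N, hermCoeff N f = 0) (n : ℕ) :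
    ∫ x : ℝ, (x : ℂ) ^ n * ((Real.exp (-x ^ 2 / 2) : ℝ) : ℂ) * f x = 0 := by
  have key : ∀ n N, toDist f ((mulS ^ n) (hermS N)) = 0 := by
    intro n
    induction n with
    | zero => exact h
    | succ n ih =>
      intro N
      rw [pow_succ, mul_apply_eq_comp, mulS_hermS, map_smul, map_add, map_smul,
        map_smul, map_add, map_smul, ih, ih]
      simp
  have hpow : ∀ (ψ : 𝓢(ℝ, ℂ)) (x : ℝ), ((mulS ^ n) ψ) x = (x : ℂ) ^ n * ψ x := by
    intro ψ x
    clear key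
    induction n generalizing ψ with
    | zero => simp
    | succ n ih => rw [pow_succ', mul_apply_eq_comp, mulS_apply, ih, pow_succ]; ring
  rw [← key n 0, toDist_apply]
  refine integral_congr_ae (Filter.Eventually.of_forall fun x => ?_)
  simp only [hpow, hermS_apply, hermiteFun]

theorem integral_exp_mul_gaussian_mul_eq_zero {f : L2} (h : ∀ N, hermCoeff N f = 0) (t : ℝ) :
    ∫ x : ℝ, Complex.exp ((t * x : ℝ) * Complex.I) *
      (((Real.exp (-x ^ 2 / 2) : ℝ) : ℂ) * f x) = 0 := by
  have hexp : ∀ x : ℝ, HasSum (fun n : ℕ => ‖f x‖ * Real.exp (-x ^ 2 / 2) *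
      (|t * x| ^ n / n.factorial)) (Real.exp (-x ^ 2 / 2) * Real.exp (|t * x|) * ‖f x‖) := by
    intro x
    have := (NormedSpace.expSeries_div_hasSum_exp |t * x|).mul_left
      (‖f x‖ * Real.exp (-x ^ 2 / 2))
    rw [← Real.exp_eq_exp_ℝ] at this
    rw [mul_right_comm, mul_comm (Real.exp _) ‖f x‖]
    exact this
  have hs := hasSum_integral_of_dominated_convergence (μ := volume)
    (F := fun (n : ℕ) (x : ℝ) => ((t * x : ℝ) * Complex.I) ^ n / (n.factorial : ℂ) *
      (((Real.exp (-x ^ 2 / 2) : ℝ) : ℂ) * f x))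
    (f := fun x : ℝ => Complex.exp ((t * x : ℝ) * Complex.I) *
      (((Real.exp (-x ^ 2 / 2) : ℝ) : ℂ) * f x))
    (fun n x => ‖f x‖ * Real.exp (-x ^ 2 / 2) * (|t * x| ^ n / n.factorial))
    (fun n => by
      have hf : AEStronglyMeasurable f volume := Lp.aestronglyMeasurable f
      refine AEStronglyMeasurable.mul ?_ (AEStronglyMeasurable.mul ?_ hf)
      · exact Continuous.aestronglyMeasurable (by fun_prop)
      · exact Continuous.aestronglyMeasurable (by fun_prop))
    (fun n => Filter.Eventually.of_forall fun x => by
      simp only [norm_mul, norm_div, norm_pow, Complex.norm_real, Complex.norm_I, mul_one,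
        Real.norm_eq_abs, Real.abs_exp, Complex.norm_natCast]
      rw [mul_comm, mul_comm ‖f x‖, abs_mul])
    (Filter.Eventually.of_forall fun x => (hexp x).summable)
    (by simp only [(hexp _).tsum_eq]; exact integrable_gaussian_mul_exp f t)
    (Filter.Eventually.of_forall fun x => by
      have := (NormedSpace.expSeries_div_hasSum_exp (((t * x : ℝ) : ℂ) * Complex.I)).mul_right
        (((Real.exp (-x ^ 2 / 2) : ℝ) : ℂ) * f x)
      rwa [← Complex.exp_eq_exp_ℂ] at this)
  refine hs.unique ?_
  refine hasSum_of_eq (hasSum_zero : HasSum (fun _ : ℕ => (0 : ℂ)) 0) fun n => ?_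
  have h1 : (fun x : ℝ => ((t * x : ℝ) * Complex.I) ^ n / (n.factorial : ℂ) *
      (((Real.exp (-x ^ 2 / 2) : ℝ) : ℂ) * f x)) = fun x : ℝ =>
      ((t * Complex.I) ^ n / (n.factorial : ℂ)) *
        ((x : ℂ) ^ n * ((Real.exp (-x ^ 2 / 2) : ℝ) : ℂ) * f x) := by
    funext x
    push_cast
    ring
  symm
  rw [h1, integral_const_mul, integral_pow_mul_gaussian_mul_eq_zero h, mul_zero]

open FourierTransform in
-- All moments of `g = e^{-x²/2} f` vanish; summing the exponential series shows that its Fourier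
-- transform vanishes. Every Schwartz function is a Fourier transform, so `g` annihilates all test
-- functions and is zero almost everywhere.
theorem eq_zero_of_hermCoeff_eq_zero {f : L2} (h : ∀ N, hermCoeff N f = 0) : f = 0 := by
  set g : ℝ → ℂ := fun x => ((Real.exp (-x ^ 2 / 2) : ℝ) : ℂ) * f x with hg
  have hgi : Integrable g := by
    have := integrable_gaussian_mul_exp f 0
    refine this.mono ?_ (Filter.Eventually.of_forall fun x => ?_)
    · exact AEStronglyMeasurable.mul (Continuous.aestronglyMeasurable (by fun_prop))
        (Lp.aestronglyMeasurable f)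
    · rw [hg, norm_mul, Complex.norm_real]
      simp
  have hF : 𝓕 g = 0 := by
    funext w
    rw [Real.fourier_eq']
    have := integral_exp_mul_gaussian_mul_eq_zero h (-2 * Real.pi * w)
    rw [Pi.zero_apply, ← this]
    refine integral_congr_ae (Filter.Eventually.of_forall fun x => ?_)
    simp only [smul_eq_mul, RCLike.inner_apply, conj_trivial, hg, mul_assoc]
  have hψ : ∀ ψ : 𝓢(ℝ, ℂ), ∫ x, ψ x * g x = 0 := by
    intro ψ
    obtain ⟨χ, rfl⟩ : ∃ χ : 𝓢(ℝ, ℂ), ψ = 𝓕 χ := ⟨𝓕⁻ ψ, by simp⟩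
    have := VectorFourier.integral_fourierIntegral_smul_eq_flip (L := innerₗ ℝ)
      Real.continuous_fourierChar continuous_inner (χ.integrable (μ := volume)) hgi
    have h2 : VectorFourier.fourierIntegral Real.fourierChar volume (innerₗ ℝ).flip g = 0 := by
      rw [flip_innerₗ]; exact hF
    rw [h2] at this
    simp only [smul_eq_mul, Pi.zero_apply, mul_zero, integral_zero] at this
    exact this
  have h0 : g =ᵐ[volume] 0 := by
    refine ae_eq_zero_of_integral_contDiff_smul_eq_zero hgi.locallyIntegrable ?_
    intro φ hφ hc
    have hg₁ : HasCompactSupport (Complex.ofRealCLM ∘ φ) := hc.comp_left rfl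
    have hg₂ : ContDiff ℝ ((⊤ : ℕ∞) : WithTop ℕ∞) (Complex.ofRealCLM ∘ φ) :=
      Complex.ofRealCLM.contDiff.comp hφ
    have := hψ (hg₁.toSchwartzMap hg₂)
    simpa using this
  rw [Lp.eq_zero_iff_ae_eq_zero]
  filter_upwards [h0] with x hx
  have : ((Real.exp (-x ^ 2 / 2) : ℝ) : ℂ) ≠ 0 := by exact_mod_cast (Real.exp_pos _).ne'
  exact (mul_eq_zero.1 hx).resolve_left this

/-! ### The Hermite basis -/

/-- The normalized Hermite functions. -/
def hermE (N : ℕ) : L2 := ((‖hermL N‖⁻¹ : ℝ) : ℂ) • hermL N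

theorem orthonormal_hermE : Orthonormal ℂ hermE := by
  constructor
  · intro N
    rw [hermE, norm_smul, Complex.norm_real, norm_inv, norm_norm,
      inv_mul_cancel₀ (norm_ne_zero_iff.2 (hermL_ne_zero N))]
  · intro m n hmn
    rw [hermE, hermE, inner_smul_left, inner_smul_right, inner_hermL_of_ne hmn]
    simp

theorem inner_hermE (N : ℕ) (f : L2) :
    inner ℂ (hermE N) f = ((‖hermL N‖⁻¹ : ℝ) : ℂ) * hermCoeff N f := by
  rw [hermE, inner_smul_left, inner_hermL, Complex.conj_ofReal]

theorem inv_norm_hermL_ne_zero (N : ℕ) : ((‖hermL N‖⁻¹ : ℝ) : ℂ) ≠ 0 := by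
  simpa using hermL_ne_zero N

/-- The Hilbert basis of `L²(ℝ)` of the normalized Hermite functions. -/
def hermBasis : HilbertBasis ℕ ℂ L2 :=
  HilbertBasis.mkOfOrthogonalEqBot orthonormal_hermE (by
    rw [Submodule.eq_bot_iff]
    intro f hf
    refine eq_zero_of_hermCoeff_eq_zero fun N => ?_
    have := (Submodule.mem_orthogonal _ f).1 hf (hermE N)
      (Submodule.subset_span (Set.mem_range_self N))
    rw [inner_hermE] at this
    exact (mul_eq_zero.1 this).resolve_left (inv_norm_hermL_ne_zero N))

theorem hermBasis_apply (N : ℕ) : hermBasis N = hermE N := by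
  rw [hermBasis, HilbertBasis.coe_mkOfOrthogonalEqBot]

theorem inner_hermBasis (N : ℕ) (f : L2) :
    inner ℂ (hermBasis N) f = ((‖hermL N‖⁻¹ : ℝ) : ℂ) * hermCoeff N f := by
  rw [hermBasis_apply, inner_hermE]

/-! ### The harmonic oscillator in terms of Hermite coefficients -/

theorem continuous_toDist_apply (ψ : 𝓢(ℝ, ℂ)) : Continuous fun f : L2 => toDist f ψ :=
  (PointwiseConvergenceCLM.evalCLM (RingHom.id ℂ) ℂ ψ).continuous.comp
    (Lp.toTemperedDistributionCLM ℂ (volume : Measure ℝ) 2).continuous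

theorem toDist_hermL (N : ℕ) (ψ : 𝓢(ℝ, ℂ)) : toDist (hermL N) ψ = hermCoeff N (schwartzL ψ) := by
  rw [hermL, toDist_toLp, hermCoeff_apply, schwartzL_apply, toDist_toLp]
  simp only [mul_comm]

theorem hasSum_toDist (f : L2) (ψ : 𝓢(ℝ, ℂ)) :
    HasSum (fun N => ((‖hermL N‖⁻¹ : ℝ) : ℂ) ^ 2 * hermCoeff N f * hermCoeff N (schwartzL ψ))
      (toDist f ψ) := by
  have h := (hermBasis.hasSum_repr f).map
    (⟨⟨fun f : L2 => toDist f ψ, by simp⟩,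
      fun x y => congrArg (fun T : 𝓢'(ℝ, ℂ) => T ψ) (map_add toDist x y)⟩ : L2 →+ ℂ)
    (continuous_toDist_apply ψ)
  refine hasSum_of_eq h fun N => ?_
  change toDist (hermBasis.repr f N • hermBasis N) ψ = _
  rw [HilbertBasis.repr_apply_apply, inner_hermBasis, hermBasis_apply, hermE, smul_smul, map_smul]
  change _ * toDist (hermL N) ψ = _
  rw [toDist_hermL]
  ring

/-- Describes the maximal domain together with the action of the oscillator. For the converse, both
sides are expanded in Hermite coefficients against a test function. -/
theorem oscillator_toDist_eq_iff (f g : L2) :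
    oscillator (toDist f) = toDist g ↔ ∀ N : ℕ, (N + 1 / 2 : ℂ) * hermCoeff N f = hermCoeff N g := by
  constructor
  · intro h N
    have := DFunLike.congr_fun h (hermS N)
    rw [oscillator_toDist_apply, oscS_hermS, map_smul] at this
    exact this
  · intro h
    ext1 ψ
    rw [oscillator_toDist_apply]
    refine (hasSum_toDist f (oscS ψ)).unique (hasSum_of_eq (hasSum_toDist g ψ) fun N => ?_)
    rw [← h, hermCoeff_schwartzL_oscS]
    ring

theorem oscillator_add_mulX_toDist_eq_iff (a : ℝ) (f g : L2) :
    oscillator (toDist f) + (a : ℂ) • mulX (toDist f) = toDist g ↔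
      oscillator (toDist (translation a f)) =
        toDist (translation a g + ((a ^ 2 / 2 : ℝ) : ℂ) • translation a f) := by
  have key : ∀ ψ : 𝓢(ℝ, ℂ), (oscillator (toDist f) + (a : ℂ) • mulX (toDist f)) (transS (-a) ψ) =
      oscillator (toDist (translation a f)) ψ -
        ((a ^ 2 / 2 : ℝ) : ℂ) • toDist (translation a f) ψ := by
    intro ψ
    change oscillator (toDist f) (transS (-a) ψ) + (a : ℂ) • mulX (toDist f) (transS (-a) ψ) = _
    rw [oscillator_toDist_apply, mulX_toDist_apply, ← map_smul, ← map_add, oscS_add_mulS_transS,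
      oscillator_toDist_apply, toDist_translation, toDist_translation, map_sub, map_smul]
  constructor
  · intro h
    ext1 ψ
    have := key ψ
    rw [h, ← toDist_translation] at this
    rw [map_add, map_smul]
    change _ = toDist (translation a g) ψ + ((a ^ 2 / 2 : ℝ) : ℂ) • toDist (translation a f) ψ
    rw [this, sub_add_cancel]
  · intro h
    ext1 ψ
    have h1 : ψ = transS (-a) (transS a ψ) := by
      rw [transS_transS, neg_add_cancel, transS_zero]
    rw [h1, key, h, map_add, map_smul]
    change toDist (translation a g) _ + ((a ^ 2 / 2 : ℝ) : ℂ) • toDist (translation a f) _ - _ = _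
    rw [add_sub_cancel_right, toDist_translation]

/-! ### Bounded perturbations of the number operator -/

section Perturbation

variable {E : Type*} [NormedAddCommGroup E] [InnerProductSpace ℂ E]

theorem norm_le_of_coeff_le (b : HilbertBasis ℕ ℂ E) {u w : E}
    (h : ∀ n, ‖(inner ℂ (b n) u : ℂ)‖ ≤ ‖(inner ℂ (b n) w : ℂ)‖) : ‖u‖ ≤ ‖w‖ := by
  rw [← b.repr.norm_map u, ← b.repr.norm_map w]
  refine lp.norm_mono (by norm_num) fun n => ?_
  rw [b.repr_apply_apply, b.repr_apply_apply]
  exact h n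

theorem eq_of_coeff_eq (b : HilbertBasis ℕ ℂ E) {u w : E}
    (h : ∀ n, (inner ℂ (b n) u : ℂ) = inner ℂ (b n) w) : u = w := by
  apply b.repr.injective
  ext n
  rw [b.repr_apply_apply, b.repr_apply_apply, h]

theorem inner_basis (b : HilbertBasis ℕ ℂ E) (m n : ℕ) :
    (inner ℂ (b m) (b n) : ℂ) = if m = n then 1 else 0 :=
  orthonormal_iff_ite.1 b.orthonormal m n

theorem norm_basis (b : HilbertBasis ℕ ℂ E) (n : ℕ) : ‖b n‖ = 1 := b.orthonormal.1 n

/-- Used to build the reduced resolvent of `D` at a level. -/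
theorem exists_diagonal (b : HilbertBasis ℕ ℂ E) (d : ℕ → ℂ) (hd : ∀ n, ‖d n‖ ≤ 1) :
    ∃ S : E →L[ℂ] E, ∀ v n, (inner ℂ (b n) (S v) : ℂ) = d n * inner ℂ (b n) v := by
  have hmem : ∀ f : lp (fun _ : ℕ => ℂ) 2, Memℓp (fun n => d n * f n) 2 := fun f =>
    (lp.memℓp f).mono' fun n => by
      rw [norm_mul]
      exact mul_le_of_le_one_left (norm_nonneg _) (hd n)
  let S₀ : E →ₗ[ℂ] E :=
    { toFun := fun v => b.repr.symm ⟨fun n => d n * b.repr v n, hmem _⟩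
      map_add' := fun u v => by
        rw [← map_add]
        congr 1
        ext n
        simp [mul_add]
        rfl
      map_smul' := fun a v => by
        rw [RingHom.id_apply, ← map_smul]
        congr 1
        ext n
        simp [mul_left_comm] }
  have hS : ∀ v n, (inner ℂ (b n) (S₀ v) : ℂ) = d n * inner ℂ (b n) v := by
    intro v n
    rw [← b.repr_apply_apply, ← b.repr_apply_apply]
    simp [S₀]
  refine ⟨S₀.mkContinuous 1 fun v => ?_, hS⟩
  rw [one_mul]
  refine norm_le_of_coeff_le b fun n => ?_
  rw [hS, norm_mul]
  exact mul_le_of_le_one_left (norm_nonneg _) (hd n)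

/-- `v` is in the kernel of `D + ε B - lam`, where `D` is the operator with the eigenvalues `n + 1 / 2`
and the eigenvectors `b n`; expressed in terms of the coefficients with respect to `b`. -/
def IsPerturbedEigenvector (b : HilbertBasis ℕ ℂ E) (B : E →L[ℂ] E) (ε lam : ℂ) (v : E) : Prop :=
  ∀ n : ℕ, (n + 1 / 2 - lam) * inner ℂ (b n) v + ε * inner ℂ (b n) (B v) = 0

variable {b : HilbertBasis ℕ ℂ E} {B : E →L[ℂ] E}

/-- The usual argument for symmetric operators, done coefficientwise by Parseval so that no domain
of `D` intervenes. With `u = v` it shows that eigenvalues are real, and otherwise that eigenvectors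
of distinct eigenvalues are orthogonal. -/
theorem IsPerturbedEigenvector.sub_mul_inner_eq_zero
    (hB : ∀ u v, (inner ℂ (B u) v : ℂ) = inner ℂ u (B v)) {ε : ℝ} {lam lam' : ℂ} {u v : E}
    (hu : IsPerturbedEigenvector b B ε lam u) (hv : IsPerturbedEigenvector b B ε lam' v) :
    ((starRingEnd ℂ) lam - lam') * inner ℂ u v = 0 := by
  have h1 := (b.hasSum_inner_mul_inner u v).mul_left ((starRingEnd ℂ) lam - lam')
  have h2 := ((b.hasSum_inner_mul_inner u (B v)).sub
    (b.hasSum_inner_mul_inner (B u) v)).mul_left (ε : ℂ)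
  rw [hB, sub_self, mul_zero] at h2
  have h3 := h1.add h2
  rw [add_zero] at h3
  refine h3.unique (hasSum_of_eq hasSum_zero fun n => ?_)
  have e1 := congrArg (starRingEnd ℂ) (hu n)
  have e2 := hv n
  simp only [map_add, map_mul, map_sub, map_natCast, map_one, map_zero, map_div₀, map_ofNat,
    Complex.conj_ofReal, inner_conj_symm] at e1
  linear_combination (inner ℂ (b n) v) * e1 - (inner ℂ u (b n)) * e2

/-- At distance at least `1/8` from every level, `D - lam` is inverted with norm at most `8`, so
`‖v‖ ≤ 8|ε|‖B v‖ < ‖v‖`. -/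
theorem IsPerturbedEigenvector.exists_near {ε lam : ℝ} {v : E}
    (hv : IsPerturbedEigenvector b B ε lam v) (h0 : v ≠ 0) (hε : |ε| * ‖B‖ < 1 / 8) :
    ∃ n : ℕ, |(n : ℝ) + 1 / 2 - lam| < 1 / 8 := by
  by_contra! h
  have h1 : ‖v‖ ≤ ‖((8 * ε : ℝ) : ℂ) • B v‖ := by
    refine norm_le_of_coeff_le b fun n => ?_
    have h2 : ((n : ℂ) + 1 / 2 - lam) * inner ℂ (b n) v = - (ε * inner ℂ (b n) (B v)) :=
      eq_neg_of_add_eq_zero_left (hv n)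
    have h3 := congrArg norm h2
    have h4 : ((n : ℂ) + 1 / 2 - lam) = (((n : ℝ) + 1 / 2 - lam : ℝ) : ℂ) := by push_cast; ring
    rw [norm_neg, norm_mul, norm_mul, h4, Complex.norm_real, Complex.norm_real,
      Real.norm_eq_abs, Real.norm_eq_abs] at h3
    rw [inner_smul_right, norm_mul, Complex.norm_real, Real.norm_eq_abs, abs_mul, mul_assoc, ← h3]
    have := mul_le_mul_of_nonneg_right (h n) (norm_nonneg (inner ℂ (b n) v : ℂ))
    norm_num
    linarith
  rw [norm_smul, Complex.norm_real, Real.norm_eq_abs, abs_mul] at h1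
  have h2 := mul_le_mul_of_nonneg_left (B.le_opNorm v) (abs_nonneg ε)
  have h3 := mul_lt_mul_of_pos_right hε (norm_pos_iff.2 h0)
  norm_num at h1
  linarith

/-- All levels other than `N` are at distance at least `1/2` from `lam`, so the part of `v` off `b
N` is at most `2|ε|‖B v‖`. -/
theorem IsPerturbedEigenvector.norm_sub_le {ε lam : ℝ} {v : E} {N : ℕ}
    (hv : IsPerturbedEigenvector b B ε lam v) (hε : |ε| * ‖B‖ < 1 / 8)
    (hN : |(N : ℝ) + 1 / 2 - lam| ≤ 1 / 2) :
    ‖v - (inner ℂ (b N) v : ℂ) • b N‖ ≤ ‖v‖ / 4 := by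
  have h1 : ‖v - (inner ℂ (b N) v : ℂ) • b N‖ ≤ ‖((2 * ε : ℝ) : ℂ) • B v‖ := by
    refine norm_le_of_coeff_le b fun n => ?_
    rw [inner_sub_right, inner_smul_right, inner_basis]
    rcases eq_or_ne n N with rfl | hn
    · simp
      positivity
    rw [if_neg hn, mul_zero, sub_zero]
    have h2 : ((n : ℂ) + 1 / 2 - lam) * inner ℂ (b n) v = - (ε * inner ℂ (b n) (B v)) :=
      eq_neg_of_add_eq_zero_left (hv n)
    have h3 := congrArg norm h2
    have h4 : ((n : ℂ) + 1 / 2 - lam) = (((n : ℝ) + 1 / 2 - lam : ℝ) : ℂ) := by push_cast; ring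
    rw [norm_neg, norm_mul, norm_mul, h4, Complex.norm_real, Complex.norm_real,
      Real.norm_eq_abs, Real.norm_eq_abs] at h3
    rw [inner_smul_right, norm_mul, Complex.norm_real, Real.norm_eq_abs, abs_mul, mul_assoc, ← h3]
    have h5 : 1 / 2 ≤ |(n : ℝ) + 1 / 2 - lam| := by
      rw [abs_le] at hN
      rw [le_abs]
      rcases lt_or_gt_of_ne hn with h | h
      · right
        have : (n : ℝ) + 1 ≤ N := by exact_mod_cast h
        linarith [hN.1, hN.2]
      · left
        have : (N : ℝ) + 1 ≤ n := by exact_mod_cast h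
        linarith [hN.1, hN.2]
    have := mul_le_mul_of_nonneg_right h5 (norm_nonneg (inner ℂ (b n) v : ℂ))
    norm_num at this ⊢
    linarith
  rw [norm_smul, Complex.norm_real, Real.norm_eq_abs, abs_mul] at h1
  have h2 := mul_le_mul_of_nonneg_left (B.le_opNorm v) (abs_nonneg ε)
  have h3 := mul_le_mul_of_nonneg_right hε.le (norm_nonneg v)
  norm_num at h1
  linarith

/-- Distinct eigenvalues would make `u` and `v` orthogonal, but both are nearly parallel to `b N`:
this would give `(3/4)² ‖u‖‖v‖ ≤ (1/2) ‖u‖‖v‖`. -/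
theorem IsPerturbedEigenvector.eigenvalue_unique
    (hB : ∀ u v, (inner ℂ (B u) v : ℂ) = inner ℂ u (B v)) {ε lam lam' : ℝ} {u v : E} {N : ℕ}
    (hu : IsPerturbedEigenvector b B ε lam u) (hv : IsPerturbedEigenvector b B ε lam' v)
    (hu0 : u ≠ 0) (hv0 : v ≠ 0) (hε : |ε| * ‖B‖ < 1 / 8)
    (hN : |(N : ℝ) + 1 / 2 - lam| ≤ 1 / 2) (hN' : |(N : ℝ) + 1 / 2 - lam'| ≤ 1 / 2) :
    lam = lam' := by
  have h := hu.sub_mul_inner_eq_zero hB hv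
  rw [Complex.conj_ofReal] at h
  rcases mul_eq_zero.1 h with h | h
  · exact Complex.ofReal_injective (sub_eq_zero.1 h)
  exfalso
  have h1 := hu.norm_sub_le hε hN
  have h2 := hv.norm_sub_le hε hN'
  set c : ℂ := inner ℂ (b N) u
  set d : ℂ := inner ℂ (b N) v
  have hc : ‖c‖ ≤ ‖u‖ := by
    have := norm_inner_le_norm (𝕜 := ℂ) (b N) u
    rwa [norm_basis, one_mul] at this
  have hcb : ‖c • b N‖ = ‖c‖ := by rw [norm_smul, norm_basis, mul_one]
  have hdb : ‖d • b N‖ = ‖d‖ := by rw [norm_smul, norm_basis, mul_one]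
  have hc' : 3 / 4 * ‖u‖ ≤ ‖c‖ := by
    have := norm_sub_norm_le u (c • b N)
    rw [hcb] at this
    linarith
  have hd' : 3 / 4 * ‖v‖ ≤ ‖d‖ := by
    have := norm_sub_norm_le v (d • b N)
    rw [hdb] at this
    linarith
  have h3 : inner ℂ (c • b N) (d • b N) = -(inner ℂ (u - c • b N) v : ℂ)
      - inner ℂ (c • b N) (v - d • b N) := by
    rw [inner_sub_left, inner_sub_right, h]
    ring
  have h4 : ‖(inner ℂ (c • b N) (d • b N) : ℂ)‖ = ‖c‖ * ‖d‖ := by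
    rw [inner_smul_left, inner_smul_right, inner_basis, if_pos rfl]
    simp
  have h5 : ‖c‖ * ‖d‖ ≤ ‖u‖ / 4 * ‖v‖ + ‖u‖ * (‖v‖ / 4) := by
    rw [← h4, h3]
    refine (_root_.norm_sub_le _ _).trans ?_
    rw [norm_neg]
    gcongr
    · exact (norm_inner_le_norm _ _).trans (by gcongr)
    · refine (norm_inner_le_norm _ _).trans ?_
      rw [hcb]
      gcongr
  have hup := norm_pos_iff.2 hu0
  have hvp := norm_pos_iff.2 hv0
  have h6 : (3 / 4 * ‖u‖) * (3 / 4 * ‖v‖) ≤ ‖c‖ * ‖d‖ := by gcongr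
  have := mul_pos hup hvp
  nlinarith

/-! ### Analytic eigenvalue branches by the implicit function theorem. -/

variable [CompleteSpace E]

/-- Lyapunov–Schmidt reduction with the normalization `(b N, v) = 1`. A complex parameter is used
because complex differentiability near `0` already gives analyticity. -/
theorem exists_analytic_eigenvalue_complex (b : HilbertBasis ℕ ℂ E) (B : E →L[ℂ] E) (N : ℕ) :
    ∃ μ : ℂ → ℂ, AnalyticAt ℂ μ 0 ∧ μ 0 = 0 ∧ deriv μ 0 = inner ℂ (b N) (B (b N)) ∧
      ∀ᶠ ε in nhds (0 : ℂ), ∃ v ≠ 0, IsPerturbedEigenvector b B ε (N + 1 / 2 + μ ε) v := by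
  -- The reduced resolvent at level `N`: the convention `0⁻¹ = 0` makes it vanish on `b N`.
  obtain ⟨S, hS⟩ := exists_diagonal b (fun n => ((n : ℂ) - N)⁻¹) (fun n => by
    rcases eq_or_ne n N with rfl | hn
    · simp
    rw [norm_inv]
    apply inv_le_one_of_one_le₀
    have : ((n : ℂ) - N) = ((n - N : ℤ) : ℂ) := by push_cast; ring
    rw [this, Complex.norm_intCast]
    have h : (n : ℤ) - N ≠ 0 := sub_ne_zero.2 (by exact_mod_cast hn)
    exact_mod_cast Int.one_le_abs h)
  have hSN : S (b N) = 0 := eq_of_coeff_eq b fun n => by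
    rw [hS, inner_basis, inner_zero_right]
    rcases eq_or_ne n N with rfl | hn
    · simp
    · simp [hn]
  -- The zeros `(v, μ)` encode the equation off `b N`, solved for `v` with bounded operators only,
  -- and its `b N` component. At `ε = 0` the partial derivative is the identity because `S (b N) =
  -- 0`.
  let G : ℂ × (E × ℂ) → E × ℂ := fun p =>
    (p.2.1 - b N - S (p.2.2 • p.2.1 - p.1 • B p.2.1), p.2.2 - p.1 * innerSL ℂ (b N) (B p.2.1))
  let u₀ : ℂ × (E × ℂ) := (0, (b N, 0))
  have hG : ContDiff ℂ 1 G := by fun_prop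
  have hGu : G u₀ = 0 := by simp [G, u₀]
  have hd : fderiv ℂ G u₀ ∘L .inr ℂ ℂ (E × ℂ) = ContinuousLinearMap.id ℂ (E × ℂ) := by
    have h1 : HasFDerivAt (fun y : E × ℂ => G (0, y)) (fderiv ℂ G u₀ ∘L .inr ℂ ℂ (E × ℂ))
        (b N, 0) :=
      ((hG.differentiable (by norm_num)) u₀).hasFDerivAt.comp (b N, (0 : ℂ))
        (hasFDerivAt_prodMk_right (0 : ℂ) (b N, (0 : ℂ)))
    have h2 : HasFDerivAt (fun y : E × ℂ => G (0, y)) (ContinuousLinearMap.id ℂ (E × ℂ))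
        (b N, 0) := by
      have h3 : HasFDerivAt (fun y : E × ℂ => y.2 • y.1) _ (b N, (0 : ℂ)) :=
        (hasFDerivAt_snd (𝕜 := ℂ) (p := (b N, (0 : ℂ)))).smul hasFDerivAt_fst
      have h4 := ((hasFDerivAt_fst (𝕜 := ℂ) (p := (b N, (0 : ℂ)))).sub_const (b N)).sub
        (S.hasFDerivAt.comp _ h3)
      have h5 := h4.prodMk (hasFDerivAt_snd (𝕜 := ℂ) (p := (b N, (0 : ℂ))))
      refine (h5.congr_fderiv ?_).congr_of_eventuallyEq (Filter.Eventually.of_forall fun y => ?_)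
      · ext x <;> simp [hSN]
      · simp [G]
    exact h1.unique h2
  have hinv : (fderiv ℂ G u₀ ∘L .inr ℂ ℂ (E × ℂ)).IsInvertible := by
    rw [hd]
    exact ⟨ContinuousLinearEquiv.refl ℂ _, rfl⟩
  have hcd : ContDiffAt ℂ 1 G u₀ := hG.contDiffAt
  set ψ := hcd.implicitFunction one_ne_zero hinv with hψ
  have hψ0 : ψ 0 = (b N, 0) := hcd.implicitFunction_apply_self one_ne_zero hinv
  have hψd : ContDiffAt ℂ 1 ψ 0 := hcd.contDiffAt_implicitFunction one_ne_zero hinv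
  have hψe : ∀ᶠ ε in nhds (0 : ℂ), G (ε, ψ ε) = 0 := by
    have := hcd.eventually_apply_implicitFunction one_ne_zero hinv
    rw [hGu] at this
    exact this
  have hψe1 : ∀ᶠ ε in nhds (0 : ℂ),
      (ψ ε).1 = b N + S ((ψ ε).2 • (ψ ε).1 - ε • B (ψ ε).1) := by
    filter_upwards [hψe] with ε h
    have := congrArg Prod.fst h
    simp only [G, Prod.fst_zero] at this
    rw [← sub_eq_zero, ← this]
    abel
  have hψe2 : ∀ᶠ ε in nhds (0 : ℂ), (ψ ε).2 = ε * inner ℂ (b N) (B (ψ ε).1) := by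
    filter_upwards [hψe] with ε h
    exact sub_eq_zero.1 (congrArg Prod.snd h)
  refine ⟨fun ε => (ψ ε).2, ?_, by simp [hψ0], ?_, ?_⟩
  · rw [Complex.analyticAt_iff_eventually_differentiableAt]
    have := hψd.eventually (by simp)
    filter_upwards [this] with ε h
    exact (h.differentiableAt one_ne_zero).snd
  · have h1 : HasDerivAt (fun ε : ℂ => ε * inner ℂ (b N) (B (ψ ε).1))
        (inner ℂ (b N) (B (b N))) 0 := by
      have h2 : DifferentiableAt ℂ (fun ε : ℂ => innerSL ℂ (b N) (B (ψ ε).1)) 0 :=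
        ((innerSL ℂ (b N)).differentiableAt.comp _ (B.differentiableAt.comp _
          (hψd.differentiableAt one_ne_zero).fst))
      have h3 := (hasDerivAt_id (0 : ℂ)).mul h2.hasDerivAt
      refine h3.congr_deriv ?_
      simp [hψ0]
    exact (h1.congr_of_eventuallyEq hψe2).deriv
  · filter_upwards [hψe1, hψe2] with ε h1 h2
    have hc : ∀ n, (inner ℂ (b n) (ψ ε).1 : ℂ) = (if n = N then 1 else 0) + ((n : ℂ) - N)⁻¹ *
        ((ψ ε).2 * inner ℂ (b n) (ψ ε).1 - ε * inner ℂ (b n) (B (ψ ε).1)) := by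
      intro n
      conv_lhs => rw [h1]
      rw [inner_add_right, inner_basis, hS, inner_sub_right, inner_smul_right, inner_smul_right]
    have hN : (inner ℂ (b N) (ψ ε).1 : ℂ) = 1 := by
      have := hc N
      rwa [if_pos rfl, sub_self, inv_zero, zero_mul, add_zero] at this
    refine ⟨(ψ ε).1, ?_, fun n => ?_⟩
    · intro h
      rw [h, inner_zero_right] at hN
      exact zero_ne_one hN
    rcases eq_or_ne n N with rfl | hn
    · rw [hN, ← h2]
      ring
    · have hne : (n : ℂ) - N ≠ 0 := sub_ne_zero.2 (by exact_mod_cast hn)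
      have := hc n
      rw [if_neg hn, zero_add, eq_inv_mul_iff_mul_eq₀ hne] at this
      linear_combination this

theorem exists_analytic_eigenvalue (b : HilbertBasis ℕ ℂ E) (B : E →L[ℂ] E)
    (hB : ∀ u v, (inner ℂ (B u) v : ℂ) = inner ℂ u (B v)) (N : ℕ) :
    ∃ (a : ℕ → ℝ) (lam : ℝ → ℝ), a 0 = N + 1 / 2 ∧
      a 1 = (inner ℂ (b N) (B (b N)) : ℂ).re ∧ ∃ c > 0, ∀ ε : ℝ, |ε| < c →
        HasSum (fun n => a n * ε ^ n) (lam ε) ∧ |(N : ℝ) + 1 / 2 - lam ε| < 1 / 8 ∧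
        ∃ v ≠ 0, IsPerturbedEigenvector b B ε (lam ε : ℂ) v := by
  obtain ⟨μ, ⟨p, hp⟩, h0, h1, he⟩ := exists_analytic_eigenvalue_complex b B N
  have hcont : ContinuousAt μ 0 := hp.continuousAt
  have hnear : ∀ᶠ ε in nhds (0 : ℂ), ‖μ ε‖ < 1 / 8 := by
    have := hcont.norm.eventually (Iio_mem_nhds (show ‖μ 0‖ < 1 / 8 by rw [h0]; norm_num))
    exact this
  have hsum := hp.eventually_hasSum
  obtain ⟨c, hc, hball⟩ := Metric.eventually_nhds_iff.1 ((he.and hnear).and hsum)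
  refine ⟨fun n => (if n = 0 then (N : ℝ) + 1 / 2 else 0) + (p.coeff n).re,
    fun ε => N + 1 / 2 + (μ ε).re, ?_, ?_, c, hc, fun ε hε => ?_⟩
  · have := hp.coeff_zero (fun _ => 1)
    rw [FormalMultilinearSeries.apply_eq_pow_smul_coeff, h0, pow_zero, one_smul] at this
    simp [this]
  · have := hp.deriv
    rw [h1, FormalMultilinearSeries.apply_eq_pow_smul_coeff, one_pow, one_smul] at this
    simp [this]
  · obtain ⟨⟨⟨v, hv0, hv⟩, hn⟩, hs⟩ := hball (y := (ε : ℂ)) (by simpa using hε)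
    -- Symmetry makes the branch real for real `ε`, so real parts of the Taylor coefficients
    -- suffice.
    have hreal : (starRingEnd ℂ) ((N : ℂ) + 1 / 2 + μ ε) = (N : ℂ) + 1 / 2 + μ ε := by
      have h := hv.sub_mul_inner_eq_zero hB hv
      refine sub_eq_zero.1 ((mul_eq_zero.1 h).resolve_right ?_)
      exact inner_self_ne_zero.2 hv0
    have hre : (N : ℂ) + 1 / 2 + μ ε = (((N : ℝ) + 1 / 2 + (μ ε).re : ℝ) : ℂ) := by
      rw [← Complex.conj_eq_iff_re.1 hreal]
      simp
    refine ⟨?_, ?_, v, hv0, ?_⟩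
    · rw [zero_add] at hs
      have h2 := Complex.hasSum_re hs
      have h3 : HasSum (fun n : ℕ => (if n = 0 then (N : ℝ) + 1 / 2 else 0) * ε ^ n)
          ((N : ℝ) + 1 / 2) := by
        have := hasSum_single (f := fun n : ℕ => (if n = 0 then (N : ℝ) + 1 / 2 else 0) * ε ^ n) 0
          (fun n hn => by simp [hn])
        simpa using this
      have h4 := h3.add h2
      convert h4 using 2 with n
      rw [FormalMultilinearSeries.apply_eq_pow_smul_coeff, smul_eq_mul, ← Complex.ofReal_pow,
        Complex.re_ofReal_mul]
      ring
    · rw [show (N : ℝ) + 1 / 2 - (N + 1 / 2 + (μ ε).re) = - (μ ε).re by ring, abs_neg]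
      exact (Complex.abs_re_le_norm _).trans_lt hn
    · rw [← hre]
      exact hv

end Perturbation

/-! ### The eigenspaces -/

theorem mem_eigenspace_conjugatedOp {α γ₁ γ₂ ε lam : ℝ} {u : L2C2} :
    u ∈ eigenspace (conjugatedOp α γ₁ γ₂ ε) lam ↔
      oscillator (toDist (u 0)) = toDist ((lam : ℂ) • u 0 - (ε : ℂ) •
        ((((γ₁ + γ₂) / 2 : ℝ) : ℂ) • u 0 +
          (((γ₁ - γ₂) / 2 : ℝ) : ℂ) • translation α (translation α (u 1)))) ∧
      oscillator (toDist (u 1)) = toDist ((lam : ℂ) • u 1 - (ε : ℂ) •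
        ((((γ₁ - γ₂) / 2 : ℝ) : ℂ) • translation (-α) (translation (-α) (u 0)) +
          (((γ₁ + γ₂) / 2 : ℝ) : ℂ) • u 1)) := by
  change (u, (lam : ℂ) • u) ∈ (maximalOp _ _).graph ↔ _
  rw [mem_graph_maximalOp, funext_iff, Fin.forall_fin_two]
  refine and_congr ?_ ?_
  · rw [map_sub, eq_sub_iff_add_eq]
    rfl
  · rw [map_sub, eq_sub_iff_add_eq]
    rfl

theorem mem_eigenspace_rabiOp {α γ₁ γ₂ ε ν : ℝ} {w : L2C2} :
    w ∈ eigenspace (rabiOp α γ₁ γ₂ ε) ν ↔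
      oscillator (toDist (w 0)) + (α : ℂ) • mulX (toDist (w 1)) +
        ((ε * γ₁ : ℝ) : ℂ) • toDist (w 0) = (ν : ℂ) • toDist (w 0) ∧
      oscillator (toDist (w 1)) + (α : ℂ) • mulX (toDist (w 0)) +
        ((ε * γ₂ : ℝ) : ℂ) • toDist (w 1) = (ν : ℂ) • toDist (w 1) := by
  change (w, (ν : ℂ) • w) ∈ (maximalOp _ _).graph ↔ _
  rw [mem_graph_maximalOp, LinearMap.zero_apply, map_zero, add_zero, funext_iff,
    Fin.forall_fin_two, map_smul]
  rfl

/-- The transformation which diagonalizes the coupling of the Rabi system and removes the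
resulting linear potentials `± α x` by translations. -/
def conjugation (α : ℝ) : L2C2 ≃ₗ[ℂ] L2C2 where
  toFun w := WithLp.toLp 2 ![translation α (w 0 + w 1), translation (-α) (w 0 - w 1)]
  map_add' v w := by
    ext1 i
    fin_cases i
    · simp; abel
    · simp; abel
  map_smul' a w := by
    ext1 i
    fin_cases i
    · simp
    · simp [smul_sub]
  invFun v := WithLp.toLp 2 ![(1 / 2 : ℂ) • (translation (-α) (v 0) + translation α (v 1)),
    (1 / 2 : ℂ) • (translation (-α) (v 0) - translation α (v 1))]
  left_inv w := by
    ext1 i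
    fin_cases i
    · change (1 / 2 : ℂ) • (translation (-α) (translation α (w 0 + w 1)) +
        translation α (translation (-α) (w 0 - w 1))) = w 0
      rw [translation_neg_translation, translation_translation_neg]
      module
    · change (1 / 2 : ℂ) • (translation (-α) (translation α (w 0 + w 1)) -
        translation α (translation (-α) (w 0 - w 1))) = w 1
      rw [translation_neg_translation, translation_translation_neg]
      module
  right_inv v := by
    ext1 i
    fin_cases i
    · simp [translation_neg_translation, translation_translation_neg]
      module
    · simp [translation_neg_translation, translation_translation_neg]
      module

theorem conjugation_apply_zero (α : ℝ) (w : L2C2) :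
    conjugation α w 0 = translation α (w 0 + w 1) := rfl

theorem conjugation_apply_one (α : ℝ) (w : L2C2) :
    conjugation α w 1 = translation (-α) (w 0 - w 1) := rfl

/-- In the sum and difference of the components, the diagonal matrix of the `γ`'s becomes `β₁` plus
`β₂` times the swap. The swap turns into `T_±²` after the translations, and completing the square
costs `α²/2`. -/
theorem mem_eigenspace_rabiOp_iff {α γ₁ γ₂ ε ν : ℝ} {w : L2C2} :
    w ∈ eigenspace (rabiOp α γ₁ γ₂ ε) ν ↔
      conjugation α w ∈ eigenspace (conjugatedOp α γ₁ γ₂ ε) (ν + α ^ 2 / 2) := by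
  have h1 := oscillator_add_mulX_toDist_eq_iff α (w 0 + w 1) ((ν : ℂ) • (w 0 + w 1) - (ε : ℂ) •
    ((((γ₁ + γ₂) / 2 : ℝ) : ℂ) • (w 0 + w 1) + (((γ₁ - γ₂) / 2 : ℝ) : ℂ) • (w 0 - w 1)))
  have h2 := oscillator_add_mulX_toDist_eq_iff (-α) (w 0 - w 1) ((ν : ℂ) • (w 0 - w 1) - (ε : ℂ) •
    ((((γ₁ + γ₂) / 2 : ℝ) : ℂ) • (w 0 - w 1) + (((γ₁ - γ₂) / 2 : ℝ) : ℂ) • (w 0 + w 1)))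
  rw [mem_eigenspace_rabiOp, mem_eigenspace_conjugatedOp, conjugation_apply_zero,
    conjugation_apply_one, translation_translation_neg, translation_neg_translation]
  have e1 : (((ν + α ^ 2 / 2 : ℝ) : ℂ) • translation α (w 0 + w 1) - (ε : ℂ) •
        ((((γ₁ + γ₂) / 2 : ℝ) : ℂ) • translation α (w 0 + w 1) +
          (((γ₁ - γ₂) / 2 : ℝ) : ℂ) • translation α (w 0 - w 1))) =
      translation α ((ν : ℂ) • (w 0 + w 1) - (ε : ℂ) •
        ((((γ₁ + γ₂) / 2 : ℝ) : ℂ) • (w 0 + w 1) + (((γ₁ - γ₂) / 2 : ℝ) : ℂ) • (w 0 - w 1))) +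
      ((α ^ 2 / 2 : ℝ) : ℂ) • translation α (w 0 + w 1) := by
    simp only [map_sub, map_smul, map_add, Complex.ofReal_add]
    module
  have e2 : (((ν + α ^ 2 / 2 : ℝ) : ℂ) • translation (-α) (w 0 - w 1) - (ε : ℂ) •
        ((((γ₁ - γ₂) / 2 : ℝ) : ℂ) • translation (-α) (w 0 + w 1) +
          (((γ₁ + γ₂) / 2 : ℝ) : ℂ) • translation (-α) (w 0 - w 1))) =
      translation (-α) ((ν : ℂ) • (w 0 - w 1) - (ε : ℂ) •
        ((((γ₁ + γ₂) / 2 : ℝ) : ℂ) • (w 0 - w 1) + (((γ₁ - γ₂) / 2 : ℝ) : ℂ) • (w 0 + w 1))) +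
      (((-α) ^ 2 / 2 : ℝ) : ℂ) • translation (-α) (w 0 - w 1) := by
    simp only [map_sub, map_smul, map_add, Complex.ofReal_add, neg_sq]
    module
  rw [e1, e2, ← h1, ← h2]
  simp only [map_add, map_sub, map_smul]
  generalize toDist (w 0) = a
  generalize toDist (w 1) = c
  generalize oscillator a = oa
  generalize oscillator c = oc
  generalize mulX a = xa
  generalize mulX c = xc
  push_cast
  constructor
  · rintro ⟨e, e'⟩
    constructor
    · linear_combination (norm := module) e + e'
    · linear_combination (norm := module) e - e'
  · rintro ⟨e, e'⟩
    constructor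
    · linear_combination (norm := module) (1 / 2 : ℂ) • e + (1 / 2 : ℂ) • e'
    · linear_combination (norm := module) (1 / 2 : ℂ) • e - (1 / 2 : ℂ) • e'

theorem eigenspace_rabiOp (α γ₁ γ₂ ε ν : ℝ) :
    eigenspace (rabiOp α γ₁ γ₂ ε) ν = (eigenspace (conjugatedOp α γ₁ γ₂ ε) (ν + α ^ 2 / 2)).map
      ((conjugation α).symm : L2C2 →ₗ[ℂ] L2C2) := by
  ext w
  rw [← Submodule.comap_equiv_eq_map_symm, Submodule.mem_comap]
  exact mem_eigenspace_rabiOp_iff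

theorem finrank_eigenspace_rabiOp (α γ₁ γ₂ ε ν : ℝ) :
    Module.finrank ℂ (eigenspace (rabiOp α γ₁ γ₂ ε) ν) =
      Module.finrank ℂ (eigenspace (conjugatedOp α γ₁ γ₂ ε) (ν + α ^ 2 / 2)) := by
  rw [eigenspace_rabiOp]
  exact LinearEquiv.finrank_map_eq _ _

theorem isEigenvalue_rabiOp_iff {α γ₁ γ₂ ε ν : ℝ} :
    IsEigenvalue (rabiOp α γ₁ γ₂ ε) ν ↔
      IsEigenvalue (conjugatedOp α γ₁ γ₂ ε) (ν + α ^ 2 / 2) := by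
  rw [IsEigenvalue, IsEigenvalue, eigenspace_rabiOp]
  exact not_congr (Submodule.map_eq_bot_iff (e := (conjugation α).symm))

/-! ### The parity sectors -/

/-- The restriction of the perturbation `B` to the subspace `u₁ = s u₀(-·)` of `L²(ℝ; ℂ²)`,
as an operator acting on `u₀`. -/
def sectorOp (α γ₁ γ₂ : ℝ) (s : ℤˣ) : L2 →L[ℂ] L2 :=
  (((γ₁ + γ₂) / 2 : ℝ) : ℂ) • ContinuousLinearMap.id ℂ L2 +
    ((((s : ℤ) : ℝ) * ((γ₁ - γ₂) / 2) : ℝ) : ℂ) •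
      ((translationIso (2 * α)).toContinuousLinearMap ∘L reflection.toContinuousLinearMap)

theorem sectorOp_apply (α γ₁ γ₂ : ℝ) (s : ℤˣ) (f : L2) :
    sectorOp α γ₁ γ₂ s f = (((γ₁ + γ₂) / 2 : ℝ) : ℂ) • f +
      ((((s : ℤ) : ℝ) * ((γ₁ - γ₂) / 2) : ℝ) : ℂ) • translation (2 * α) (reflection f) := rfl

theorem inner_sectorOp_left (α γ₁ γ₂ : ℝ) (s : ℤˣ) (f g : L2) :
    inner ℂ (sectorOp α γ₁ γ₂ s f) g = inner ℂ f (sectorOp α γ₁ γ₂ s g) := by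
  rw [sectorOp_apply, sectorOp_apply, inner_add_left, inner_add_right, inner_smul_left,
    inner_smul_left, inner_smul_right, inner_smul_right, inner_translation_left,
    inner_reflection_left, reflection_translation, neg_neg, Complex.conj_ofReal,
    Complex.conj_ofReal]

theorem isPerturbedEigenvector_sectorOp_iff {α γ₁ γ₂ ε lam : ℝ} {s : ℤˣ} {f : L2} :
    IsPerturbedEigenvector hermBasis (sectorOp α γ₁ γ₂ s) ε lam f ↔
      oscillator (toDist f) = toDist ((lam : ℂ) • f - (ε : ℂ) • sectorOp α γ₁ γ₂ s f) := by
  rw [oscillator_toDist_eq_iff]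
  refine forall_congr' fun n => ?_
  rw [inner_hermBasis, inner_hermBasis, map_sub, map_smul, map_smul, smul_eq_mul, smul_eq_mul]
  constructor
  · intro h
    apply mul_left_cancel₀ (inv_norm_hermL_ne_zero n)
    linear_combination h
  · intro h
    linear_combination ((‖hermL n‖⁻¹ : ℝ) : ℂ) * h

theorem oscillator_toDist_reflection {f g : L2} (h : oscillator (toDist f) = toDist g) :
    oscillator (toDist (reflection f)) = toDist (reflection g) := by
  rw [oscillator_toDist_eq_iff] at h ⊢
  intro N
  rw [hermCoeff_reflection, hermCoeff_reflection, ← h]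
  ring

theorem units_mul_self (s : ℤˣ) : ((s : ℤ) : ℂ) * ((s : ℤ) : ℂ) = 1 := by
  rcases Int.units_eq_one_or s with rfl | rfl <;> simp

/-- The vector `(f, s f(-·))` of the parity sector `s`. -/
def sectorVec (s : ℤˣ) (f : L2) : L2C2 := WithLp.toLp 2 ![f, ((s : ℤ) : ℂ) • reflection f]

theorem sectorVec_mem_eigenspace {α γ₁ γ₂ ε lam : ℝ} {s : ℤˣ} {f : L2}
    (h : IsPerturbedEigenvector hermBasis (sectorOp α γ₁ γ₂ s) ε lam f) :
    sectorVec s f ∈ eigenspace (conjugatedOp α γ₁ γ₂ ε) lam := by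
  rw [isPerturbedEigenvector_sectorOp_iff] at h
  have hr := oscillator_toDist_reflection h
  rw [mem_eigenspace_conjugatedOp]
  change oscillator (toDist f) = toDist ((lam : ℂ) • f - (ε : ℂ) •
      (_ • f + _ • translation α (translation α (((s : ℤ) : ℂ) • reflection f)))) ∧
    oscillator (toDist (((s : ℤ) : ℂ) • reflection f)) = toDist ((lam : ℂ) •
      (((s : ℤ) : ℂ) • reflection f) - (ε : ℂ) • (_ • translation (-α) (translation (-α) f) +
        _ • (((s : ℤ) : ℂ) • reflection f)))
  constructor
  · rw [h, sectorOp_apply, translation_translation, map_smul, ← two_mul]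
    congr 1
    push_cast
    module
  · rw [map_smul toDist, map_smul oscillator, hr, ← map_smul toDist, sectorOp_apply]
    congr 1
    simp only [map_sub, map_smul, map_add, reflection_translation, reflection_reflection,
      translation_translation, ← two_mul, mul_neg]
    push_cast
    have := units_mul_self s
    generalize translation (-(2 * α)) f = g
    generalize reflection f = k
    generalize ((s : ℤ) : ℂ) = σ at *
    have h2 : (σ * σ) • g = g := by rw [this, one_smul]
    linear_combination (norm := module) (-(ε * ((γ₁ - γ₂) / 2)) : ℂ) • h2

/-- The vector is twice the first component of the projection of `u` to the sector `s`, which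
commutes with `A + ε B`. -/
theorem sector_component {α γ₁ γ₂ ε lam : ℝ} (s : ℤˣ) {u : L2C2}
    (h : u ∈ eigenspace (conjugatedOp α γ₁ γ₂ ε) lam) :
    IsPerturbedEigenvector hermBasis (sectorOp α γ₁ γ₂ s) ε lam
      (u 0 + ((s : ℤ) : ℂ) • reflection (u 1)) := by
  rw [mem_eigenspace_conjugatedOp] at h
  obtain ⟨h0, h1⟩ := h
  have hr := oscillator_toDist_reflection h1
  rw [isPerturbedEigenvector_sectorOp_iff, map_add toDist, map_add oscillator, map_smul toDist,
    map_smul oscillator, h0, hr, ← map_smul toDist, ← map_add toDist, sectorOp_apply]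
  congr 1
  simp only [map_add, map_sub, map_smul, reflection_translation, reflection_reflection,
    translation_translation, ← two_mul, mul_neg, neg_neg]
  have := units_mul_self s
  push_cast
  generalize translation (2 * α) (u 1) = g
  generalize translation (2 * α) (reflection (u 0)) = k
  generalize ((s : ℤ) : ℂ) = σ at *
  have h2 : (σ * σ) • g = g := by rw [this, one_smul]
  linear_combination (norm := module) (ε * ((γ₁ - γ₂) / 2) : ℂ) • h2

theorem exists_sector_eigenvector {α γ₁ γ₂ ε lam : ℝ}
    (h : IsEigenvalue (conjugatedOp α γ₁ γ₂ ε) lam) :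
    ∃ (s : ℤˣ) (f : L2), f ≠ 0 ∧
      IsPerturbedEigenvector hermBasis (sectorOp α γ₁ γ₂ s) ε lam f := by
  obtain ⟨u, hu, hu0⟩ := (Submodule.ne_bot_iff _).1 h
  by_contra! hc
  have h1 : u 0 + ((1 : ℤˣ) : ℤ) • reflection (u 1) = 0 := by
    by_contra h1
    have := sector_component 1 hu
    exact hc 1 _ (by simpa using h1) this
  have h2 : u 0 + ((-1 : ℤˣ) : ℤ) • reflection (u 1) = 0 := by
    by_contra h2
    have := sector_component (-1) hu
    exact hc (-1) _ (by simpa using h2) this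
  simp at h1 h2
  apply hu0
  have h3 : (2 : ℂ) • u 0 = 0 := by rw [two_smul]; linear_combination (norm := module) h1 + h2
  have h4 : u 0 = 0 := (smul_eq_zero.1 h3).resolve_left two_ne_zero
  have h5 : u 1 = 0 := by
    rw [h4, zero_add] at h1
    rw [← reflection_reflection (u 1), h1, map_zero]
  ext1 i
  fin_cases i
  · exact h4
  · exact h5

theorem isEigenvalue_of_sector {α γ₁ γ₂ ε lam : ℝ} {s : ℤˣ} {f : L2} (hf : f ≠ 0)
    (h : IsPerturbedEigenvector hermBasis (sectorOp α γ₁ γ₂ s) ε lam f) :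
    IsEigenvalue (conjugatedOp α γ₁ γ₂ ε) lam := by
  refine (Submodule.ne_bot_iff _).2 ⟨_, sectorVec_mem_eigenspace h, fun h0 => hf ?_⟩
  exact congrArg (fun u : L2C2 => u 0) h0

theorem sectorVec_eq_smul {s : ℤˣ} {f g : L2} {c : ℂ}
    (h : sectorVec s f = c • sectorVec (-s) g) : f = 0 := by
  have h0 : f = c • g := congrArg (fun u : L2C2 => u 0) h
  have h1 : ((s : ℤ) : ℂ) • reflection f = c • (((-s : ℤˣ) : ℤ) : ℂ) • reflection g :=
    congrArg (fun u : L2C2 => u 1) h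
  have h2 : (2 : ℂ) • reflection f = 0 := by
    have h3 : reflection f = c • reflection g := by rw [h0, map_smul]
    have := units_mul_self s
    have h4 : ((s : ℤ) : ℂ) • ((2 : ℂ) • reflection f) = 0 := by
      push_cast at h1
      linear_combination (norm := module) h1 + ((s : ℤ) : ℂ) • h3
    refine (smul_eq_zero.1 h4).resolve_left ?_
    intro h5
    rw [h5] at this
    simp at this
  have h3 := (smul_eq_zero.1 h2).resolve_left two_ne_zero
  rw [← reflection_reflection f, h3, map_zero]

/-! ### The recurrence relations for the Hermite coefficients of an eigenvector -/

/-- A sequence of polynomials which describes the dependence on the first of the coefficients of an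
eigenvector, for the eigenvalue which corresponds to the `N`-th level. -/
def levelPoly (κ ρ : ℂ) (N : ℕ) : ℕ → Polynomial ℂ
  | 0 => 1
  | 1 => Polynomial.C (κ⁻¹ * (0 - N + ρ)) - Polynomial.C (κ⁻¹ * ((0 : ℂ) - N)⁻¹) * Polynomial.X
  | n + 2 => Polynomial.C (κ⁻¹ * ((n + 1 : ℕ) - N + ρ)) * levelPoly κ ρ N (n + 1) -
      Polynomial.C (κ⁻¹ * (((n + 1 : ℕ) : ℂ) - N)⁻¹) * (levelPoly κ ρ N (n + 1) * Polynomial.X) -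
      Polynomial.C ((n + 1 : ℕ) : ℂ) * levelPoly κ ρ N n

theorem levelPoly_succ (κ ρ : ℂ) (N n : ℕ) : levelPoly κ ρ N (n + 1) =
    Polynomial.C (κ⁻¹ * ((n : ℂ) - N + ρ)) * levelPoly κ ρ N n -
      Polynomial.C (κ⁻¹ * ((n : ℂ) - N)⁻¹) * (levelPoly κ ρ N n * Polynomial.X) -
      Polynomial.C (n : ℂ) * levelPoly κ ρ N (n - 1) := by
  cases n with
  | zero => simp [levelPoly]
  | succ n => rw [levelPoly, Nat.add_sub_cancel]

theorem natDegree_levelPoly_le (κ ρ : ℂ) (N n : ℕ) : (levelPoly κ ρ N n).natDegree ≤ n := by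
  induction n using Nat.strong_induction_on with
  | _ n ih =>
    cases n with
    | zero => simp [levelPoly]
    | succ n =>
      rw [levelPoly_succ]
      have h1 := ih n (by omega)
      have h2 := ih (n - 1) (by omega)
      refine (Polynomial.natDegree_sub_le_of_le (Polynomial.natDegree_sub_le_of_le
        ((Polynomial.natDegree_C_mul_le _ _).trans h1)
        ((Polynomial.natDegree_C_mul_le _ _).trans (Polynomial.natDegree_mul_le.trans
          (Nat.add_le_add h1 Polynomial.natDegree_X_le))))
        ((Polynomial.natDegree_C_mul_le _ _).trans h2)).trans ?_
      omega

/-- Each step below level `N` multiplies the top coefficient by `-κ⁻¹ (n - N)⁻¹`, which is nonzero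
as `n < N`. -/
theorem coeff_levelPoly_ne_zero {κ : ℂ} (hκ : κ ≠ 0) (ρ : ℂ) {N n : ℕ} (hn : n ≤ N) :
    (levelPoly κ ρ N n).coeff n ≠ 0 := by
  induction n with
  | zero => simp [levelPoly]
  | succ n ih =>
    have h1 : (levelPoly κ ρ N n).coeff (n + 1) = 0 :=
      Polynomial.coeff_eq_zero_of_natDegree_lt
        ((natDegree_levelPoly_le κ ρ N n).trans_lt (by omega))
    have h2 : (levelPoly κ ρ N (n - 1)).coeff (n + 1) = 0 :=
      Polynomial.coeff_eq_zero_of_natDegree_lt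
        ((natDegree_levelPoly_le κ ρ N (n - 1)).trans_lt (by omega))
    rw [levelPoly_succ, Polynomial.coeff_sub, Polynomial.coeff_sub, Polynomial.coeff_C_mul,
      Polynomial.coeff_C_mul, Polynomial.coeff_C_mul, Polynomial.coeff_mul_X, h1, h2]
    have h3 : (n : ℂ) - N ≠ 0 := sub_ne_zero.2 (by norm_cast; omega)
    have := ih (by omega)
    simp [hκ, h3, this]

theorem levelPoly_ne_zero {κ : ℂ} (hκ : κ ≠ 0) (ρ : ℂ) (N : ℕ) : levelPoly κ ρ N N ≠ 0 := by
  intro h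
  apply coeff_levelPoly_ne_zero hκ ρ le_rfl (N := N)
  rw [h, Polynomial.coeff_zero]

section Recurrence

variable {κ ρ Δ x : ℂ} {f h : ℕ → ℂ}

/-- The second relation climbs from `h 0` since `κ ≠ 0`; the first yields `f n` except at the
resonance `n = x`, where it has to be given. -/
theorem recurrence_eq_zero (hκ : κ ≠ 0) (hf : ∀ n : ℕ, (n - x) * f n + Δ * h n = 0)
    (hh : ∀ n : ℕ, (n - x + ρ) * h n - κ * (h (n + 1) + n * h (n - 1)) + Δ * f n = 0)
    (h0 : h 0 = 0) (hx : ∀ n : ℕ, (n : ℂ) = x → f n = 0) (n : ℕ) : f n = 0 ∧ h n = 0 := by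
  have hfh : ∀ n, h n = 0 → f n = 0 := by
    intro n hn
    by_cases hnx : (n : ℂ) = x
    · exact hx n hnx
    · have := hf n
      rw [hn, mul_zero, add_zero] at this
      exact (mul_eq_zero.1 this).resolve_left (sub_ne_zero.2 hnx)
  have key : ∀ n, h n = 0 := by
    intro n
    induction n using Nat.strong_induction_on with
    | _ n ih =>
      cases n with
      | zero => exact h0
      | succ n =>
        have e := hh n
        have h1 := ih n (by omega)
        rw [h1, hfh n h1, ih (n - 1) (by omega)] at e
        have : κ * h (n + 1) = 0 := by linear_combination -e
        exact (mul_eq_zero.1 this).resolve_left hκ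
  exact ⟨hfh n (key n), key n⟩

/-- Below the resonance `f n` can be eliminated, leaving a recurrence for `h` in which `Δ` enters
only through `Δ²`. -/
theorem recurrence_eq_levelPoly (hκ : κ ≠ 0) {N : ℕ}
    (hf : ∀ n : ℕ, ((n : ℂ) - N) * f n + Δ * h n = 0)
    (hh : ∀ n : ℕ, ((n : ℂ) - N + ρ) * h n - κ * (h (n + 1) + n * h (n - 1)) + Δ * f n = 0)
    {n : ℕ} (hn : n ≤ N) : h n = (levelPoly κ ρ N n).eval (Δ ^ 2) * h 0 := by
  induction n using Nat.strong_induction_on with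
  | _ n ih =>
    cases n with
    | zero => simp [levelPoly]
    | succ n =>
      have e := hh n
      have e' := hf n
      have h1 := ih n (by omega) (by omega)
      have h2 := ih (n - 1) (by omega) (by omega)
      have h3 : (n : ℂ) - N ≠ 0 := sub_ne_zero.2 (by norm_cast; omega)
      have h4 : f n = - ((n : ℂ) - N)⁻¹ * Δ * h n := by
        field_simp
        linear_combination e'
      have h5 : h (n + 1) = κ⁻¹ * (((n : ℂ) - N + ρ) * h n + Δ * f n) - n * h (n - 1) := by
        field_simp
        linear_combination -e
      rw [h5, h4, h1, h2, levelPoly_succ]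
      simp only [Polynomial.eval_sub, Polynomial.eval_mul, Polynomial.eval_C, Polynomial.eval_X]
      ring

/-- At the resonance the first relation forces `h N = 0`, hence `h 0 = 0` by `hP`; the only free
parameter left is `f N`. -/
theorem recurrence_eq_zero_of_level (hκ : κ ≠ 0) (hΔ : Δ ≠ 0) {N : ℕ}
    (hf : ∀ n : ℕ, ((n : ℂ) - N) * f n + Δ * h n = 0)
    (hh : ∀ n : ℕ, ((n : ℂ) - N + ρ) * h n - κ * (h (n + 1) + n * h (n - 1)) + Δ * f n = 0)
    (hP : (levelPoly κ ρ N N).eval (Δ ^ 2) ≠ 0) (hN : f N = 0) (n : ℕ) : f n = 0 ∧ h n = 0 := by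
  refine recurrence_eq_zero hκ hf hh ?_ (fun n hn => ?_) n
  · have h1 := hf N
    rw [sub_self, zero_mul, zero_add] at h1
    have h2 := (mul_eq_zero.1 h1).resolve_left hΔ
    rw [recurrence_eq_levelPoly hκ hf hh le_rfl] at h2
    exact (mul_eq_zero.1 h2).resolve_left hP
  · have : n = N := by exact_mod_cast hn
    rw [this, hN]

end Recurrence

/-! ### One-dimensionality of the eigenspaces of `A + ε B`. -/

theorem hermCoeff_recurrence {α γ₁ γ₂ ε lam : ℝ} {u : L2C2}
    (hu : u ∈ eigenspace (conjugatedOp α γ₁ γ₂ ε) lam) (n : ℕ) :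
    ((n : ℂ) - ((lam - 1 / 2 - ε * ((γ₁ + γ₂) / 2) : ℝ) : ℂ)) * hermCoeff n (u 0) +
      ((ε * ((γ₁ - γ₂) / 2) : ℝ) : ℂ) * hermCoeff n (translation (2 * α) (u 1)) = 0 ∧
    ((n : ℂ) - ((lam - 1 / 2 - ε * ((γ₁ + γ₂) / 2) : ℝ) : ℂ) + ((2 * α ^ 2 : ℝ) : ℂ)) *
        hermCoeff n (translation (2 * α) (u 1)) -
      ((√2 * α : ℝ) : ℂ) * (hermCoeff (n + 1) (translation (2 * α) (u 1)) +
        n * hermCoeff (n - 1) (translation (2 * α) (u 1))) +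
      ((ε * ((γ₁ - γ₂) / 2) : ℝ) : ℂ) * hermCoeff n (u 0) = 0 := by
  rw [mem_eigenspace_conjugatedOp] at hu
  obtain ⟨h0, h1⟩ := hu
  constructor
  · have := (oscillator_toDist_eq_iff _ _).1 h0 n
    simp only [map_sub, map_add, map_smul, smul_eq_mul, translation_translation,
      ← two_mul] at this
    push_cast at this ⊢
    linear_combination this
  -- In terms of `g` the coupling contains no translation; the price is the potential `-2α x`,
  -- tridiagonal by `mulS_hermS`, and the constant `2α²`.
  · set g := translation (2 * α) (u 1) with hg
    have hu1 : u 1 = translation (-(2 * α)) g := by rw [hg, translation_neg_translation]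
    have h2 := oscillator_add_mulX_toDist_eq_iff (-(2 * α)) g
      ((lam : ℂ) • g - (ε : ℂ) • ((((γ₁ - γ₂) / 2 : ℝ) : ℂ) • u 0 +
        (((γ₁ + γ₂) / 2 : ℝ) : ℂ) • g) - ((2 * α ^ 2 : ℝ) : ℂ) • g)
    have h3 := h2.2 (by
      rw [← hu1, h1]
      congr 1
      simp only [map_sub, map_add, map_smul, translation_translation, ← hu1]
      rw [show -α + -α = -(2 * α) by ring]
      push_cast
      module)
    have h4 := DFunLike.congr_fun h3 (hermS n)
    change oscillator (toDist g) (hermS n) + ((-(2 * α) : ℝ) : ℂ) • mulX (toDist g) (hermS n) = _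
      at h4
    rw [oscillator_toDist_apply, mulX_toDist_apply, oscS_hermS, mulS_hermS, map_smul, map_smul,
      map_add, map_smul] at h4
    simp only [← hermCoeff_apply] at h4
    simp only [map_sub, map_add, map_smul, smul_eq_mul] at h4
    have h5 : ((√2 * α : ℝ) : ℂ) = 2 * α * ((√2 : ℝ) : ℂ)⁻¹ := by
      have := sqrt_two_mul_self
      have h6 := sqrt_two_ne_zero
      rw [Complex.ofReal_mul]
      field_simp
      linear_combination (α : ℂ) * this
    rw [h5]
    push_cast at h4 ⊢
    linear_combination h4

theorem eq_zero_of_hermCoeff {α : ℝ} {u : L2C2}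
    (h : ∀ n, hermCoeff n (u 0) = 0 ∧ hermCoeff n (translation (2 * α) (u 1)) = 0) : u = 0 := by
  have h0 : u 0 = 0 := eq_zero_of_hermCoeff_eq_zero fun n => (h n).1
  have h1 : u 1 = 0 := by
    rw [← translation_neg_translation (2 * α) (u 1),
      eq_zero_of_hermCoeff_eq_zero fun n => (h n).2, map_zero]
  ext1 i
  fin_cases i
  · exact h0
  · exact h1

theorem finrank_eq_one_of_functional {V : Submodule ℂ L2C2} (hV : V ≠ ⊥) {ℓ : L2C2 →ₗ[ℂ] ℂ}
    (h : ∀ u ∈ V, ℓ u = 0 → u = 0) : Module.finrank ℂ V = 1 := by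
  have hinj : Function.Injective (ℓ ∘ₗ V.subtype) := by
    rw [← LinearMap.ker_eq_bot, LinearMap.ker_eq_bot']
    intro u hu
    exact Subtype.ext (h u u.2 hu)
  have hle := LinearMap.finrank_le_finrank_of_injective hinj
  rw [Module.finrank_self] at hle
  have : Module.Finite ℂ V := Module.Finite.of_injective _ hinj
  have : Nontrivial V := Submodule.nontrivial_iff_ne_bot.2 hV
  have := Module.finrank_pos (R := ℂ) (M := V)
  omega

theorem exists_functional_eigenspace_conjugatedOp {α γ₁ γ₂ ε lam : ℝ} (hα : α ≠ 0) (hγ : γ₂ < γ₁)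
    (hε : ε ≠ 0) (h : ∀ N : ℕ, lam - 1 / 2 - ε * ((γ₁ + γ₂) / 2) = N →
      (levelPoly ((√2 * α : ℝ) : ℂ) ((2 * α ^ 2 : ℝ) : ℂ) N N).eval
        (((ε * ((γ₁ - γ₂) / 2) : ℝ) : ℂ) ^ 2) ≠ 0) :
    ∃ ℓ : L2C2 →ₗ[ℂ] ℂ, ∀ u ∈ eigenspace (conjugatedOp α γ₁ γ₂ ε) lam, ℓ u = 0 → u = 0 := by
  have hκ : ((√2 * α : ℝ) : ℂ) ≠ 0 := by
    rw [Complex.ofReal_mul]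
    exact mul_ne_zero sqrt_two_ne_zero (by exact_mod_cast hα)
  have hΔ : ((ε * ((γ₁ - γ₂) / 2) : ℝ) : ℂ) ≠ 0 := by
    rw [Complex.ofReal_ne_zero]
    exact mul_ne_zero hε (by linarith)
  by_cases hx : ∃ N : ℕ, lam - 1 / 2 - ε * ((γ₁ + γ₂) / 2) = N
  · obtain ⟨N, hN⟩ := hx
    refine ⟨hermCoeff N ∘ₗ (LinearMap.proj 0 ∘ₗ
      (WithLp.linearEquiv 2 ℂ (Fin 2 → L2)).toLinearMap), fun u hu h0 => ?_⟩
    refine eq_zero_of_hermCoeff (α := α) fun n => ?_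
    have hr := hermCoeff_recurrence hu
    simp only [hN, Complex.ofReal_natCast] at hr
    exact recurrence_eq_zero_of_level hκ hΔ (fun n => (hr n).1) (fun n => (hr n).2) (h N hN) h0 n
  · push Not at hx
    refine ⟨hermCoeff 0 ∘ₗ translation (2 * α) ∘ₗ
      (LinearMap.proj 1 ∘ₗ (WithLp.linearEquiv 2 ℂ (Fin 2 → L2)).toLinearMap), fun u hu h0 => ?_⟩
    refine eq_zero_of_hermCoeff (α := α) fun n => ?_
    have hr := hermCoeff_recurrence hu
    refine recurrence_eq_zero hκ (fun n => (hr n).1) (fun n => (hr n).2) h0 (fun n hn => ?_) n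
    exact absurd (by exact_mod_cast hn.symm) (hx n)

/-! ### The first order coefficients -/

theorem reflection_hermL (N : ℕ) : reflection (hermL N) = (-1 : ℂ) ^ N • hermL N := by
  refine toDist_ext fun ψ => ?_
  rw [toDist_reflection, map_smul]
  change _ = (-1 : ℂ) ^ N • toDist (hermL N) ψ
  rw [hermL, toDist_toLp, toDist_toLp, smul_eq_mul, ← integral_const_mul,
    ← integral_neg_eq_self _ volume]
  refine integral_congr_ae (Filter.Eventually.of_forall fun x => ?_)
  simp [hermS_neg]
  ring

theorem inner_hermL_translation (α : ℝ) (N : ℕ) :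
    inner ℂ (hermL N) (translation (2 * α) (hermL N)) = (overlap α N : ℂ) := by
  rw [inner_hermL, hermCoeff_apply, toDist_translation, hermL, toDist_toLp, overlap,
    ← integral_complex_ofReal, ← integral_sub_right_eq_self _ α]
  refine integral_congr_ae (Filter.Eventually.of_forall fun x => ?_)
  simp [hermS_apply]
  ring_nf

/-- The parity `(-1)^N` of `φ_N` enters through the reflection; `overlapSign` later absorbs it and
the sign of the overlap. -/
theorem inner_hermBasis_sectorOp (α γ₁ γ₂ : ℝ) (s : ℤˣ) (N : ℕ) :
    (inner ℂ (hermBasis N) (sectorOp α γ₁ γ₂ s (hermBasis N)) : ℂ).re = (γ₁ + γ₂) / 2 +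
      ((s : ℤ) : ℝ) * ((γ₁ - γ₂) / 2) * ((-1) ^ N * overlap α N / hermiteNormSq N) := by
  have h0 := (norm_pos_iff.2 (hermL_ne_zero N)).ne'
  have h : inner ℂ (hermBasis N) (sectorOp α γ₁ γ₂ s (hermBasis N)) =
      (((γ₁ + γ₂) / 2 + ((s : ℤ) : ℝ) * ((γ₁ - γ₂) / 2) *
        ((-1) ^ N * overlap α N / hermiteNormSq N) : ℝ) : ℂ) := by
    rw [hermBasis_apply, hermE, map_smul, inner_smul_left, inner_smul_right, sectorOp_apply,
      inner_add_right, inner_smul_right, inner_smul_right, reflection_hermL, map_smul,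
      inner_smul_right, inner_hermL_self, inner_hermL_translation, Complex.conj_ofReal,
      ← norm_hermL_sq]
    have h1 : (‖hermL N‖ : ℂ) ≠ 0 := by exact_mod_cast h0
    push_cast
    field_simp
  rw [h, Complex.ofReal_re]

/-! ### Sequences which separate the roots of the Laguerre polynomials -/

theorem exists_isRootSeparating {x₀ : ℝ} (h : ∀ n, laguerre n x₀ ≠ 0) :
    ∃ (k : ℕ → ℕ) (δ : ℕ → ℝ), IsRootSeparating x₀ k δ := by
  have hd : ∀ n, ∃ d > 0, ∀ x, laguerre n x = 0 → d ≤ |x - x₀| := by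
    intro n
    have hc : Continuous (laguerre n) := by unfold laguerre; fun_prop
    obtain ⟨d, hd, hb⟩ := Metric.eventually_nhds_iff.1 (hc.continuousAt.eventually_ne (h n))
    refine ⟨d, hd, fun x hx => ?_⟩
    by_contra! hlt
    exact hb (y := x) (by rwa [Real.dist_eq]) hx
  choose d hd0 hd using hd
  let m : ℕ → ℝ := fun j => Nat.rec (min 1 (d 0)) (fun i r => min r (d (i + 1))) j
  have hms : ∀ j, m (j + 1) = min (m j) (d (j + 1)) := fun j => rfl
  have hanti : Antitone m := antitone_nat_of_succ_le fun j => by rw [hms]; exact min_le_left _ _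
  have hpos : ∀ j, 0 < m j := by
    intro j
    induction j with
    | zero => exact lt_min one_pos (hd0 0)
    | succ j ih => rw [hms]; exact lt_min ih (hd0 _)
  have hle1 : ∀ j, m j ≤ 1 := fun j => (hanti (Nat.zero_le j)).trans (min_le_left _ _)
  have hled : ∀ n, m n ≤ d n := by
    intro n
    cases n with
    | zero => exact min_le_right _ _
    | succ n => rw [hms]; exact min_le_right _ _
  have hδle : ∀ j : ℕ, m j * (1 / ((j : ℝ) + 1)) ≤ m j := fun j =>
    mul_le_of_le_one_right (hpos j).le (by
      rw [div_le_one (by positivity)]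
      linarith [(Nat.cast_nonneg j : (0 : ℝ) ≤ j)])
  -- The running minimum `m` respects all distances up to `j`, but need be neither strictly
  -- decreasing nor null; the factor `1/(j + 1)` provides both.
  refine ⟨id, fun j => m j * (1 / ((j : ℝ) + 1)), strictMono_id, fun j => ?_, ?_, ?_, ?_⟩
  · exact mul_pos (hpos j) (by positivity)
  · refine strictAnti_nat_of_succ_lt fun j => ?_
    refine mul_lt_mul' (hanti (Nat.le_succ j)) ?_ (by positivity) (hpos j)
    push_cast
    exact one_div_lt_one_div_of_lt (by positivity) (by linarith)
  · refine squeeze_zero (fun j => (mul_pos (hpos j) (by positivity)).le) (fun j => ?_)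
      tendsto_one_div_add_atTop_nhds_zero_nat
    exact mul_le_of_le_one_left (by positivity) (hle1 j)
  · intro j n hn x hx
    exact (hδle j).trans ((hanti hn).trans ((hled n).trans (hd n x hx)))

/-! ### The first eigenvalues -/

/-- The nonzero roots of `P` are finitely many and stay away from `0`; a root at `0` is avoided
since `ε β ≠ 0`. -/
theorem eventually_eval_sq_ne_zero {P : Polynomial ℂ} (hP : P ≠ 0) {β : ℝ} (hβ : β ≠ 0) :
    ∀ᶠ ε in nhds (0 : ℝ), ε ≠ 0 → P.eval (((ε * β : ℝ) : ℂ) ^ 2) ≠ 0 := by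
  have hfin : ({z : ℂ | P.IsRoot z} \ {0}).Finite := (Polynomial.finite_setOfPred_isRoot hP).sdiff
  have hopen : ({z : ℂ | P.IsRoot z} \ {0})ᶜ ∈ nhds (0 : ℂ) :=
    hfin.isClosed.isOpen_compl.mem_nhds (by simp)
  have hc : Continuous fun ε : ℝ => ((ε * β : ℝ) : ℂ) ^ 2 := by fun_prop
  have ht : Filter.Tendsto (fun ε : ℝ => ((ε * β : ℝ) : ℂ) ^ 2) (nhds 0) (nhds 0) := by
    have := hc.tendsto 0
    simpa using this
  filter_upwards [ht hopen] with ε h h0 hz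
  refine h ⟨hz, ?_⟩
  simp [h0, hβ]

/-- The sign by which the parity sector of the eigenvalue `λ_±^{(N)}` is determined. -/
def overlapSign (α : ℝ) (N : ℕ) : ℤˣ := if 0 ≤ (-1) ^ N * overlap α N then 1 else -1

theorem overlapSign_mul (α : ℝ) (N : ℕ) :
    ((overlapSign α N : ℤ) : ℝ) * ((-1) ^ N * overlap α N) = |overlap α N| := by
  have h : |overlap α N| = |(-1) ^ N * overlap α N| := by
    rw [abs_mul, abs_pow, abs_neg, abs_one, one_pow, one_mul]
  rw [h, overlapSign]
  split_ifs with h0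
  · rw [abs_of_nonneg h0]; simp
  · rw [abs_of_neg (not_le.1 h0)]; simp

theorem inner_hermBasis_sectorOp_overlapSign (α γ₁ γ₂ : ℝ) (s : ℤˣ) (N : ℕ) :
    (inner ℂ (hermBasis N) (sectorOp α γ₁ γ₂ (s * overlapSign α N) (hermBasis N)) : ℂ).re =
      firstOrderCoeff α γ₁ γ₂ N s := by
  rw [inner_hermBasis_sectorOp, firstOrderCoeff, ← overlapSign_mul]
  push_cast
  ring

theorem exists_eigenvalue_branches {α γ₁ γ₂ : ℝ} (hα : α ≠ 0) (hγ : γ₂ < γ₁) (K : ℕ) :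
    ∃ c : ℝ, 0 < c ∧ c < 1 ∧ ∃ lam : ℕ → ℤˣ → ℝ → ℝ,
      (∀ N ≤ K, ∀ s : ℤˣ,
        (∃ a : ℕ → ℝ, a 0 = (N : ℝ) + 1 / 2 ∧ a 1 = firstOrderCoeff α γ₁ γ₂ N s ∧
          ∀ ε : ℝ, |ε| < c → HasSum (fun n : ℕ => a n * ε ^ n) (lam N s ε)) ∧
        ∀ ε : ℝ, |ε| < c → |(N : ℝ) + 1 / 2 - lam N s ε| < 1 / 8 ∧ ∃ f ≠ 0,
          IsPerturbedEigenvector hermBasis (sectorOp α γ₁ γ₂ (s * overlapSign α N)) ε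
            (lam N s ε : ℂ) f) ∧
      ∀ ε : ℝ, |ε| < c → (∀ s, |ε| * ‖sectorOp α γ₁ γ₂ s‖ < 1 / 8) ∧
        |ε * ((γ₁ + γ₂) / 2)| < 1 / 8 ∧ (ε ≠ 0 → ∀ N ≤ K,
          (levelPoly ((√2 * α : ℝ) : ℂ) ((2 * α ^ 2 : ℝ) : ℂ) N N).eval
            (((ε * ((γ₁ - γ₂) / 2) : ℝ) : ℂ) ^ 2) ≠ 0) := by
  have hex := fun (N : ℕ) (s : ℤˣ) => exists_analytic_eigenvalue hermBasis
    (sectorOp α γ₁ γ₂ (s * overlapSign α N)) (inner_sectorOp_left α γ₁ γ₂ _) N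
  choose a lam ha0 ha1 r hr0 hr using hex
  have e1 : ∀ᶠ ε in nhds (0 : ℝ), ∀ N ∈ Finset.range (K + 1), ∀ s, |ε| < r N s := by
    rw [Filter.eventually_all_finset]
    intro N _
    rw [Filter.eventually_all]
    intro s
    exact (continuous_abs.tendsto' 0 0 abs_zero).eventually (Iio_mem_nhds (hr0 N s))
  have e2 : ∀ᶠ ε in nhds (0 : ℝ), ∀ s, |ε| * ‖sectorOp α γ₁ γ₂ s‖ < 1 / 8 := by
    rw [Filter.eventually_all]
    intro s
    have hc : Continuous fun ε : ℝ => |ε| * ‖sectorOp α γ₁ γ₂ s‖ := by fun_prop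
    exact (hc.tendsto' 0 0 (by simp)).eventually (Iio_mem_nhds (by norm_num))
  have e3 : ∀ᶠ ε in nhds (0 : ℝ), |ε * ((γ₁ + γ₂) / 2)| < 1 / 8 := by
    have hc : Continuous fun ε : ℝ => |ε * ((γ₁ + γ₂) / 2)| := by fun_prop
    exact (hc.tendsto' 0 0 (by simp)).eventually (Iio_mem_nhds (by norm_num))
  have hκ : ((√2 * α : ℝ) : ℂ) ≠ 0 := by
    rw [Complex.ofReal_mul]
    exact mul_ne_zero sqrt_two_ne_zero (by exact_mod_cast hα)
  have e4 : ∀ᶠ ε in nhds (0 : ℝ), ∀ N ∈ Finset.range (K + 1), ε ≠ 0 →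
      (levelPoly ((√2 * α : ℝ) : ℂ) ((2 * α ^ 2 : ℝ) : ℂ) N N).eval
        (((ε * ((γ₁ - γ₂) / 2) : ℝ) : ℂ) ^ 2) ≠ 0 := by
    rw [Filter.eventually_all_finset]
    intro N _
    exact eventually_eval_sq_ne_zero (levelPoly_ne_zero hκ _ N) (by linarith)
  obtain ⟨c, hc, hball⟩ := Metric.eventually_nhds_iff.1 (((e1.and e2).and e3).and e4)
  have hball' : ∀ ε : ℝ, |ε| < min c (1 / 2) → _ := fun ε hε => hball (y := ε)
    (by rw [Real.dist_eq, sub_zero]; exact hε.trans_le (min_le_left _ _))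
  have hmem : ∀ {N : ℕ}, N ≤ K → N ∈ Finset.range (K + 1) := fun h =>
    Finset.mem_range.2 (Nat.lt_succ_of_le h)
  refine ⟨min c (1 / 2), lt_min hc (by norm_num), (min_le_right _ _).trans_lt (by norm_num), lam,
    fun N hN s => ⟨⟨a N s, ha0 N s, ?_, fun ε hε => ?_⟩, fun ε hε => ?_⟩, fun ε hε => ?_⟩
  · rw [ha1, inner_hermBasis_sectorOp_overlapSign]
  · exact (hr N s ε ((hball' ε hε).1.1.1 N (hmem hN) s)).1
  · exact (hr N s ε ((hball' ε hε).1.1.1 N (hmem hN) s)).2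
  · obtain ⟨⟨⟨-, h2⟩, h3⟩, h4⟩ := hball' ε hε
    exact ⟨h2, h3, fun h0 N hN => h4 N (hmem hN) h0⟩

theorem eq_of_abs_sub_lt {M N : ℕ} {x : ℝ} (hM : |(M : ℝ) + 1 / 2 - x| < 1 / 2)
    (hN : |(N : ℝ) + 1 / 2 - x| < 1 / 2) : M = N := by
  rw [abs_lt] at hM hN
  have h1 : (M : ℝ) < N + 1 := by linarith [hM.2, hN.1]
  have h2 : (N : ℝ) < M + 1 := by linarith [hM.1, hN.2]
  have h3 : M < N + 1 := by exact_mod_cast h1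
  have h4 : N < M + 1 := by exact_mod_cast h2
  omega

end Rabi

end

/-! ### Assembly of the main theorem. -/

theorem mainTheorem2 (α γ₁ γ₂ : ℝ) (hα : α ≠ 0) (hγ : γ₂ < γ₁)
    (hZ : 4 * α ^ 2 ∉ Rabi.laguerreZeros) :
    (∃ (k : ℕ → ℕ) (δ : ℕ → ℝ), Rabi.IsRootSeparating (4 * α ^ 2) k δ) ∧
    ∀ (k : ℕ → ℕ) (δ : ℕ → ℝ), Rabi.IsRootSeparating (4 * α ^ 2) k δ → ∀ j : ℕ,
      ∃ c : ℝ, 0 < c ∧ c < 1 ∧ ∃ lam : ℕ → ℤˣ → ℝ → ℝ,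
        (∀ N ≤ k j, ∀ s : ℤˣ,
          (∃ a : ℕ → ℝ, a 0 = (N : ℝ) + 1 / 2 ∧ a 1 = Rabi.firstOrderCoeff α γ₁ γ₂ N s ∧
            ∀ ε : ℝ, |ε| < c → HasSum (fun n : ℕ => a n * ε ^ n) (lam N s ε)) ∧
          ∀ ε : ℝ, |ε| < c →
            Rabi.IsEigenvalue (Rabi.conjugatedOp α γ₁ γ₂ ε) (lam N s ε)) ∧
        ∀ ε : ℝ, |ε| < c →
          Rabi.IsInitialSetOfEigenvalues (Rabi.rabiOp α γ₁ γ₂ ε)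
            (Rabi.shiftedValues α (k j) (fun N s => lam N s ε)) ∧
          (ε ≠ 0 →
            (Rabi.shiftedValues α (k j) (fun N s => lam N s ε)).ncard = 2 * (k j + 1) ∧
            ∀ ν ∈ Rabi.shiftedValues α (k j) (fun N s => lam N s ε),
              Rabi.IsSimpleEigenvalue (Rabi.rabiOp α γ₁ γ₂ ε) ν) := by
  refine ⟨Rabi.exists_isRootSeparating fun n hn => hZ ⟨by positivity, n, hn⟩, ?_⟩
  intro k δ _ j
  generalize k j = K
  obtain ⟨c, hc0, hc1, lam, hlam, hc⟩ := Rabi.exists_eigenvalue_branches hα hγ K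
  have heig : ∀ N ≤ K, ∀ (s : ℤˣ) (ε : ℝ), |ε| < c →
      Rabi.IsEigenvalue (Rabi.conjugatedOp α γ₁ γ₂ ε) (lam N s ε) := by
    intro N hN s ε hε
    obtain ⟨-, f, hf0, hf⟩ := (hlam N hN s).2 ε hε
    exact Rabi.isEigenvalue_of_sector hf0 hf
  refine ⟨c, hc0, hc1, lam, fun N hN s => ⟨(hlam N hN s).1, heig N hN s⟩, fun ε hε => ?_⟩
  obtain ⟨hB, hβ, hP⟩ := hc ε hε
  have hnear : ∀ N ≤ K, ∀ s : ℤˣ, |(N : ℝ) + 1 / 2 - lam N s ε| < 1 / 8 := fun N hN s =>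
    ((hlam N hN s).2 ε hε).1
  refine ⟨⟨?_, ?_⟩, fun hε0 => ?_⟩
  · rintro ν ⟨N, hN, s, rfl⟩
    rw [Rabi.isEigenvalue_rabiOp_iff, sub_add_cancel]
    exact heig N hN s ε hε
  · rintro ν hν hνS σ ⟨N, hN, s, rfl⟩
    rw [Rabi.isEigenvalue_rabiOp_iff] at hν
    obtain ⟨t, f, hf0, hf⟩ := Rabi.exists_sector_eigenvector hν
    obtain ⟨n, hn⟩ := hf.exists_near hf0 (hB t)
    -- At a level `n ≤ K`, uniqueness within the sector `t` would identify the eigenvalue with a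
    -- listed branch; multiplying by `overlapSign` converts `t` to the label of that branch.
    have hnK : K < n := by
      by_contra! hnK
      apply hνS
      obtain ⟨h1, g, hg0, hg⟩ := (hlam n hnK (t * Rabi.overlapSign α n)).2 ε hε
      rw [mul_assoc, Int.units_mul_self, mul_one] at hg
      refine ⟨n, hnK, t * Rabi.overlapSign α n, ?_⟩
      change ν = lam n (t * Rabi.overlapSign α n) ε - α ^ 2 / 2
      rw [← hf.eigenvalue_unique (Rabi.inner_sectorOp_left α γ₁ γ₂ t) hg hf0 hg0 (hB t)
        (hn.le.trans (by norm_num)) (h1.le.trans (by norm_num))]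
      ring
    have h1 := abs_lt.1 (hnear N hN s)
    have h2 := abs_lt.1 hn
    have h3 : (N : ℝ) + 1 ≤ n := by exact_mod_cast Nat.succ_le_of_lt (hN.trans_lt hnK)
    linarith [h1.1, h2.2]
  · have hfun : ∀ N ≤ K, ∀ s : ℤˣ, ∃ ℓ : Rabi.L2C2 →ₗ[ℂ] ℂ,
        ∀ u ∈ Rabi.eigenspace (Rabi.conjugatedOp α γ₁ γ₂ ε) (lam N s ε), ℓ u = 0 → u = 0 := by
      intro N hN s
      refine Rabi.exists_functional_eigenspace_conjugatedOp hα hγ hε0 fun M hM => ?_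
      -- A resonance `M` differs from `lam - 1/2` by `|ε β₁| < 1/8`, so it can only be the level `N`
      -- of the branch.
      have hMN : M = N := by
        refine Rabi.eq_of_abs_sub_lt (x := lam N s ε) ?_ ((hnear N hN s).trans (by norm_num))
        rw [← hM, show lam N s ε - 1 / 2 - ε * ((γ₁ + γ₂) / 2) + 1 / 2 - lam N s ε =
          -(ε * ((γ₁ + γ₂) / 2)) by ring, abs_neg]
        exact hβ.trans (by norm_num)
      rw [hMN]
      exact hP hε0 N hN
    constructor
    · have hinj : Set.InjOn (fun p : ℕ × ℤˣ => lam p.1 p.2 ε - α ^ 2 / 2)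
          (Finset.range (K + 1) ×ˢ (Finset.univ : Finset ℤˣ) : Finset (ℕ × ℤˣ)) := by
        rintro ⟨N, s⟩ hNs ⟨M, t⟩ hMt h
        have hN : N ≤ K := Nat.lt_succ_iff.1 (Finset.mem_range.1
          (Finset.mem_product.1 (Finset.mem_coe.1 hNs)).1)
        have hM : M ≤ K := Nat.lt_succ_iff.1 (Finset.mem_range.1
          (Finset.mem_product.1 (Finset.mem_coe.1 hMt)).1)
        have h' : lam N s ε = lam M t ε := sub_left_injective h
        have h1 := hnear M hM t
        rw [← h'] at h1
        obtain rfl : N = M := Rabi.eq_of_abs_sub_lt ((hnear N hN s).trans (by norm_num))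
          (h1.trans (by norm_num))
        by_contra hne
        have hst : s ≠ t := fun h => hne (by rw [h])
        have hts : t = -s := by
          rcases Int.units_eq_one_or s with rfl | rfl <;>
            rcases Int.units_eq_one_or t with rfl | rfl <;> simp_all
        subst hts
        obtain ⟨-, f, hf0, hf⟩ := (hlam N hN s).2 ε hε
        obtain ⟨-, g, hg0, hg⟩ := (hlam N hN (-s)).2 ε hε
        rw [← h'] at hg
        obtain ⟨ℓ, hℓ⟩ := hfun N hN s
        have hfm := Rabi.sectorVec_mem_eigenspace hf
        have hgm := Rabi.sectorVec_mem_eigenspace hg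
        set u := Rabi.sectorVec (s * Rabi.overlapSign α N) f
        set v := Rabi.sectorVec (-s * Rabi.overlapSign α N) g with hv
        have hlv : ℓ v ≠ 0 := fun h0 => hg0 (congrArg (fun u : Rabi.L2C2 => u 0) (hℓ v hgm h0))
        -- If the two branches at level `N` met, eigenvectors of opposite parity would share an
        -- eigenspace on which `ℓ` is injective, hence be proportional.
        have huv : u - (ℓ u / ℓ v) • v = 0 := by
          refine hℓ _ (Submodule.sub_mem _ hfm (Submodule.smul_mem _ _ hgm)) ?_
          rw [map_sub, map_smul, smul_eq_mul, div_mul_cancel₀ _ hlv, sub_self]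
        rw [neg_mul] at hv
        exact hf0 (Rabi.sectorVec_eq_smul (hv ▸ sub_eq_zero.1 huv))
      have hS : Rabi.shiftedValues α K (fun N s => lam N s ε) =
          ((Finset.range (K + 1) ×ˢ (Finset.univ : Finset ℤˣ)).image
            (fun p : ℕ × ℤˣ => lam p.1 p.2 ε - α ^ 2 / 2) : Finset ℝ) := by
        ext ν
        simp only [Rabi.shiftedValues, Set.mem_ofPred_eq, Finset.coe_image, Set.mem_image,
          Finset.mem_coe, Finset.mem_product, Finset.mem_range, Finset.mem_univ, and_true,
          Prod.exists, Nat.lt_succ_iff]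
        constructor
        · rintro ⟨N, hN, s, rfl⟩
          exact ⟨N, s, hN, rfl⟩
        · rintro ⟨N, s, hN, rfl⟩
          exact ⟨N, hN, s, rfl⟩
      rw [hS, Set.ncard_coe_finset, Finset.card_image_of_injOn hinj, Finset.card_product,
        Finset.card_range, Finset.card_univ, Fintype.card_units_int, mul_comm]
    · rintro ν ⟨N, hN, s, rfl⟩
      obtain ⟨ℓ, hℓ⟩ := hfun N hN s
      rw [Rabi.IsSimpleEigenvalue, Rabi.finrank_eigenspace_rabiOp, sub_add_cancel]
      exact Rabi.finrank_eq_one_of_functional (heig N hN s ε hε) hℓ
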